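/- Let $0<d<\pi/2$ and put $\mathscr{D}_d=\{\zeta\in\mathbb{C}:|\operatorname{Im}\zeta|<d\}$, $\mathscr{D}_d^{-}=\{\zeta\in\mathscr{D}_d:\operatorname{Re}\zeta<0\}$, $\mathscr{D}_d^{+}=\{\zeta\in\mathscr{D}_d:\operatorname{Re}\zeta\ge 0\}$. Let $\psi(x)=\sinh x$, so that $\psi'(x)=\cosh x$ and $\psi^{-1}=\operatorname{arcsinh}$ on $\mathbb{R}$, and let $E_1(z;\gamma)=(1+z^2)^{-(\gamma+1)/2}$. For an integer $k$ and $h>0$ let $$J(k,h)(x)=h\left\{\frac12+\frac1\pi\operatorname{Si}[\pi(x/h-k)]\right\},\qquad \operatorname{Si}(x)=\int_0^x\frac{\sin\sigma}{\sigma}\,d\sigma .$$ **Theorem 3.1.** Assume that $f$ is analytic in $\psi(\mathscr{D}_d)$, and that there exist positive constants $K,\alpha,\beta$ such that $$|f(z)|\le K|E_1(z;\alpha)|\ \text{ for all } z\in\psi(\mathscr{D}_d^{-}),\qquad |f(z)|\le K|E_1(z;\beta)|\ \text{ for all } z\in\psi(\mathscr{D}_d^{+}).$$ Let $\mu=\min\{\alpha,\beta\}$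 and $\nu=\max\{\alpha,\beta\}$. Then $f$ is integrable on $\mathbb{R}$. Moreover, for every integer $n\ge 1$, if $$h=\sqrt{\frac{\pi d}{\mu n}},\qquad \begin{cases}M=n,\ N=\lceil\alpha n/\beta\rceil & \text{if }\mu=\alpha,\\ N=n,\ M=\lceil\beta n/\alpha\rceil & \text{if }\mu=\beta,\end{cases}$$ then $$\sup_{\tau\in\mathbb{R}}\left|\int_{-\infty}^{\tau}f(t)\,dt-\sum_{k=-M}^{N}f(\psi(kh))\,\psi'(kh)\,J(k,h)(\psi^{-1}(\tau))\right|\le C_1e^{-\sqrt{\pi d\mu n}},$$ where $C_1$ is the constant, independent of $n$, given by $$C_1=\frac{2^{\nu+1}K}{\mu}\left\{\frac{1}{(1-e^{-2\sqrt{\pi d\mu}})\{\cos d\}^{\nu}}\sqrt{\frac{\pi}{d\mu}}+1.1\right\}.$$ -/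

import Mathlib

open Real MeasureTheory

noncomputable section

namespace SincIndef

/-- The strip `{ζ : |Im ζ| < d}`. -/
def strip (d : ℝ) : Set ℂ := {ζ | |ζ.im| < d}

/-- The left half `{ζ ∈ strip d : Re ζ < 0}` of the strip. -/
def stripNeg (d : ℝ) : Set ℂ := {ζ | ζ ∈ strip d ∧ ζ.re < 0}

/-- The right half `{ζ ∈ strip d : Re ζ ≥ 0}` of the strip. -/
def stripPos (d : ℝ) : Set ℂ := {ζ | ζ ∈ strip d ∧ 0 ≤ ζ.re}

/-- `E₁(z; γ) = 1 / (1 + z²)^((γ + 1) / 2)`, with the principal power. -/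
def E1 (z : ℂ) (γ : ℝ) : ℂ := 1 / (1 + z ^ 2) ^ (((γ + 1) / 2 : ℝ) : ℂ)

/-- The sine integral `Si(x) = ∫₀ˣ sin σ / σ dσ`; `Real.sinc σ` is `sin σ / σ` for `σ ≠ 0`
and `1` for `σ = 0`. -/
def sineIntegral (x : ℝ) : ℝ := ∫ σ in (0 : ℝ)..x, Real.sinc σ

/-- The basis function `J(k,h)(x) = h {1/2 + (1/π) Si[π (x/h - k)]}`. -/
def J (k : ℤ) (h x : ℝ) : ℝ :=
  h * (1 / 2 + 1 / π * sineIntegral (π * (x / h - k)))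

/-- The mesh size `h = √(π d / (μ n))`. -/
def meshSize (d μ : ℝ) (n : ℕ) : ℝ := √(π * d / (μ * n))

/-- The lower truncation number: `M = n` if `μ = α`, and `M = ⌈β n / α⌉` if `μ = β`,
where `μ = min {α, β}` (both rules give `n` when `α = β`). -/
def lowerTrunc (α β : ℝ) (n : ℕ) : ℤ := if min α β = α then (n : ℤ) else ⌈β * n / α⌉

/-- The upper truncation number: `N = ⌈α n / β⌉` if `μ = α`, and `N = n` if `μ = β`,
where `μ = min {α, β}` (both rules give `n` when `α = β`). -/
def upperTrunc (α β : ℝ) (n : ℕ) : ℤ := if min α β = α then ⌈α * n / β⌉ else (n : ℤ)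

/-- The Sinc indefinite integration combined with the map `ψ = sinh`, whose derivative is `cosh`
and whose inverse is `arsinh`:
`∑_{k=-M}^{N} f(ψ(kh)) ψ'(kh) J(k,h)(ψ⁻¹(τ))`. -/
def sincIndefSum (f : ℂ → ℂ) (h : ℝ) (M N : ℤ) (τ : ℝ) : ℂ :=
  ∑ k ∈ Finset.Icc (-M) N,
    f ((Real.sinh (k * h) : ℝ) : ℂ) * ((Real.cosh (k * h) : ℝ) : ℂ) *
      ((J k h (Real.arsinh τ) : ℝ) : ℂ)

/-- The constant
`C₁ = (2^(ν+1) K / μ) { 1 / ((1 - exp(-2 √(π d μ))) (cos d)^ν) · √(π / (d μ)) + 1.1 }`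
with `μ = min {α, β}` and `ν = max {α, β}`. -/
def C1 (d K α β : ℝ) : ℝ :=
  (2 : ℝ) ^ (max α β + 1) * K / min α β *
    (1 / ((1 - Real.exp (-2 * √(π * d * min α β))) * Real.cos d ^ max α β) *
        √(π / (d * min α β))
      + 1.1)

end SincIndef

end

/-! Put `F ζ = cosh ζ • f (sinh ζ)`. On the real line the functions
`x ↦ sin (π (x - kh) / h) / (π (x - kh) / h)` have the primitives `J k h`, so the error of the full
sum `∑ J k h b • F (kh)` is the integral over `(-∞, b]` of the error of sinc interpolation. The
partial fraction expansion of `π / sin (π z / h)` and Cauchy's formula in `|Im ζ| < δ`, for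
`δ < d`, write that error as a difference of two integrals along `Im ζ = ± δ`, of `F` against
`sin (π s / h) / (2πi (z - s) sin (π z / h))`. Only `s` varies when this is integrated over `s ≤ b`,
and an oscillatory integral estimate gains the factor `h`, while `|sin (π z / h)| ≥ sinh (π δ / h)`
on the lines. -/

namespace SincIndef

open Filter Set
open Complex (I)
open scoped Topology Nat

theorem integral_sin_mul_exp_neg (b y : ℝ) :
    ∫ x in (0 : ℝ)..b, sin x * exp (-(x * y)) =
      (1 + y ^ 2)⁻¹ - exp (-(b * y)) * (cos b + y * sin b) / (1 + y ^ 2) := by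
  have hy : 1 + y ^ 2 ≠ 0 := by positivity
  have hderiv (x : ℝ) : HasDerivAt
      (fun x ↦ -(exp (-(x * y)) * (cos x + y * sin x) / (1 + y ^ 2)))
      (sin x * exp (-(x * y))) x := by
    have hexp : HasDerivAt (fun x : ℝ ↦ exp (-(x * y))) (exp (-(x * y)) * (-(1 * y))) x :=
      ((hasDerivAt_id x).mul_const y).neg.exp
    have htrig : HasDerivAt (fun x ↦ cos x + y * sin x) (-sin x + y * cos x) x :=
      (hasDerivAt_cos x).add ((hasDerivAt_sin x).const_mul y)
    refine ((hexp.mul htrig).div_const (1 + y ^ 2)).neg.congr_deriv ?_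
    field_simp
    ring
  rw [intervalIntegral.integral_eq_sub_of_hasDerivAt (fun x _ ↦ hderiv x)
    (Continuous.intervalIntegrable (by fun_prop) _ _)]
  simp only [zero_mul, neg_zero, exp_zero, cos_zero, sin_zero, mul_zero, add_zero, mul_one,
    one_div, sub_neg_eq_add]
  ring

theorem integral_exp_neg_mul {b : ℝ} (hb : b ≠ 0) (Y : ℝ) :
    ∫ y in (0 : ℝ)..Y, exp (-(b * y)) = (1 - exp (-(b * Y))) / b := by
  simp_rw [← neg_mul]
  rw [intervalIntegral.integral_comp_mul_left exp (neg_ne_zero.2 hb), integral_exp]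
  simp only [mul_zero, exp_zero, smul_eq_mul]
  field_simp
  ring

theorem integral_exp_neg_mul_le {b : ℝ} (hb : 0 < b) (Y : ℝ) :
    ∫ y in (0 : ℝ)..Y, exp (-(b * y)) ≤ 1 / b := by
  rw [integral_exp_neg_mul hb.ne']
  gcongr
  linarith [exp_pos (-(b * Y))]

theorem integral_sin_mul_exp_neg_right (x Y : ℝ) :
    ∫ y in (0 : ℝ)..Y, sin x * exp (-(x * y)) = sinc x - sinc x * exp (-(Y * x)) := by
  rw [intervalIntegral.integral_const_mul]
  rcases eq_or_ne x 0 with rfl | hx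
  · simp
  · rw [integral_exp_neg_mul hx, sinc_of_ne_zero hx, mul_comm Y x]
    ring

/-- Fubini for `sin x * exp (-x y)` on the rectangle `[0, b] × [0, Y]`. -/
theorem sineIntegral_sub_arctan (b Y : ℝ) :
    sineIntegral b - arctan Y = (∫ x in (0 : ℝ)..b, sinc x * exp (-(Y * x))) -
      ∫ y in (0 : ℝ)..Y, exp (-(b * y)) * (cos b + y * sin b) / (1 + y ^ 2) := by
  have swap : ∫ x in (0 : ℝ)..b, ∫ y in (0 : ℝ)..Y, sin x * exp (-(x * y)) =
      ∫ y in (0 : ℝ)..Y, ∫ x in (0 : ℝ)..b, sin x * exp (-(x * y)) := by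
    apply intervalIntegral_intervalIntegral_swap
    apply IntegrableOn.mono_set (t := uIcc 0 b ×ˢ uIcc 0 Y)
    · apply ContinuousOn.integrableOn_compact (isCompact_uIcc.prod isCompact_uIcc)
      apply Continuous.continuousOn
      unfold Function.uncurry
      fun_prop
    · exact prod_mono uIoc_subset_uIcc uIoc_subset_uIcc
  have hsinc : Continuous fun x : ℝ ↦ sinc x * exp (-(Y * x)) := by fun_prop
  have hrem : Continuous fun y : ℝ ↦ exp (-(b * y)) * (cos b + y * sin b) / (1 + y ^ 2) :=
    .div (by fun_prop) (by fun_prop) fun y ↦ by positivity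
  have hinv : Continuous fun y : ℝ ↦ (1 + y ^ 2)⁻¹ :=
    .inv₀ (by fun_prop) fun y ↦ by positivity
  simp_rw [integral_sin_mul_exp_neg, integral_sin_mul_exp_neg_right] at swap
  rw [intervalIntegral.integral_sub (continuous_sinc.intervalIntegrable _ _)
    (hsinc.intervalIntegrable _ _), intervalIntegral.integral_sub (hinv.intervalIntegrable _ _)
    (hrem.intervalIntegrable _ _), integral_inv_one_add_sq, arctan_zero, sub_zero] at swap
  unfold sineIntegral
  linarith

theorem abs_integral_sinc_mul_exp_neg_le {b Y : ℝ} (hb : 0 ≤ b) (hY : 0 < Y) :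
    |∫ x in (0 : ℝ)..b, sinc x * exp (-(Y * x))| ≤ 1 / Y := by
  refine le_trans ?_ (integral_exp_neg_mul_le hY b)
  rw [← Real.norm_eq_abs]
  refine intervalIntegral.norm_integral_le_of_norm_le hb (.of_forall fun x _ ↦ ?_)
    (Continuous.intervalIntegrable (by fun_prop) _ _)
  rw [norm_mul, Real.norm_eq_abs, Real.norm_eq_abs, abs_exp]
  exact mul_le_of_le_one_left (exp_pos _).le (abs_sinc_le_one x)

theorem abs_integral_exp_neg_mul_div_le {b Y : ℝ} (hb : 0 < b) (hY : 0 ≤ Y) :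
    |∫ y in (0 : ℝ)..Y, exp (-(b * y)) * (cos b + y * sin b) / (1 + y ^ 2)| ≤ 1 / b := by
  refine le_trans ?_ (integral_exp_neg_mul_le hb Y)
  rw [← Real.norm_eq_abs]
  refine intervalIntegral.norm_integral_le_of_norm_le hY (.of_forall fun y _ ↦ ?_)
    (Continuous.intervalIntegrable (by fun_prop) _ _)
  have hnum : |cos b + y * sin b| ≤ 1 + y ^ 2 := by
    refine abs_le_of_sq_le_sq ?_ (by positivity)
    nlinarith [sin_sq_add_cos_sq b, sq_nonneg (sin b - y * cos b), sq_nonneg y,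
      sq_nonneg (y ^ 2)]
  rw [norm_div, norm_mul, Real.norm_eq_abs, Real.norm_eq_abs, Real.norm_eq_abs, abs_exp,
    abs_of_pos (by positivity : 0 < 1 + y ^ 2), mul_div_assoc]
  exact mul_le_of_le_one_right (exp_pos _).le ((div_le_one (by positivity)).2 hnum)

theorem abs_sineIntegral_sub_pi_div_two_le {b : ℝ} (hb : 0 < b) :
    |sineIntegral b - π / 2| ≤ 1 / b := by
  have hlim : Tendsto (fun Y ↦ |sineIntegral b - arctan Y|) atTop
      (𝓝 |sineIntegral b - π / 2|) :=
    ((tendsto_arctan_atTop.mono_right nhdsWithin_le_nhds).const_sub _).abs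
  have hbound : Tendsto (fun Y : ℝ ↦ Y⁻¹ + 1 / b) atTop (𝓝 (0 + 1 / b)) :=
    tendsto_inv_atTop_zero.add_const _
  rw [zero_add] at hbound
  refine le_of_tendsto_of_tendsto hlim hbound ?_
  filter_upwards [eventually_gt_atTop 0] with Y hY
  rw [sineIntegral_sub_arctan, ← one_div Y]
  exact (abs_sub _ _).trans (add_le_add (abs_integral_sinc_mul_exp_neg_le hb.le hY)
    (abs_integral_exp_neg_mul_div_le hb hY.le))

theorem sineIntegral_zero : sineIntegral 0 = 0 :=
  intervalIntegral.integral_same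

theorem sineIntegral_neg (x : ℝ) : sineIntegral (-x) = -sineIntegral x := by
  have h := intervalIntegral.integral_comp_neg (a := 0) (b := x) sinc
  simp only [sinc_neg, neg_zero] at h
  rw [sineIntegral, sineIntegral, h, intervalIntegral.integral_symm]

theorem hasDerivAt_sineIntegral (x : ℝ) : HasDerivAt sineIntegral (sinc x) x :=
  (continuous_sinc.integral_hasStrictDerivAt 0 x).hasDerivAt

theorem nonneg_of_hasDerivAt_nonneg {g g' : ℝ → ℝ} (h0 : g 0 = 0)
    (hd : ∀ x, HasDerivAt g (g' x) x) (hg : ∀ x, 0 ≤ x → 0 ≤ g' x) {x : ℝ} (hx : 0 ≤ x) :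
    0 ≤ g x := by
  have hmono : MonotoneOn g (Ici 0) :=
    monotoneOn_of_hasDerivWithinAt_nonneg (convex_Ici 0)
      (fun y _ ↦ (hd y).continuousAt.continuousWithinAt) (fun y _ ↦ (hd y).hasDerivWithinAt)
      fun y hy ↦ hg y (interior_subset hy)
  exact h0 ▸ hmono self_mem_Ici hx hx

theorem hasDerivAt_sum_alternating (n : ℕ) (c : ℕ → ℝ) (x : ℝ) :
    HasDerivAt (fun x ↦ ∑ i ∈ Finset.range n, (-1) ^ i * x ^ (2 * i + 1) / c i)
      (∑ i ∈ Finset.range n, (-1) ^ i * ((2 * i + 1) * x ^ (2 * i)) / c i) x :=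
  .fun_sum fun i _ ↦ by
    simpa using ((hasDerivAt_pow (2 * i + 1) x).const_mul ((-1) ^ i)).div_const (c i)

/-- The Taylor remainder of `cos` at `0` after `n + 1` nonzero terms, with the sign that makes it
nonnegative on `[0, ∞)`. -/
noncomputable def cosRemainder (n : ℕ) (x : ℝ) : ℝ :=
  (-1) ^ n * (∑ i ∈ Finset.range (n + 1), (-1) ^ i * x ^ (2 * i) / (2 * i)! - cos x)

/-- The Taylor remainder of `sin` at `0` after `n + 1` nonzero terms, with the sign that makes it
nonnegative on `[0, ∞)`. -/
noncomputable def sinRemainder (n : ℕ) (x : ℝ) : ℝ :=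
  (-1) ^ n * (∑ i ∈ Finset.range (n + 1), (-1) ^ i * x ^ (2 * i + 1) / (2 * i + 1)! - sin x)

theorem hasDerivAt_sinRemainder (n : ℕ) (x : ℝ) :
    HasDerivAt (sinRemainder n) (cosRemainder n x) x := by
  refine (((hasDerivAt_sum_alternating (n + 1) (fun i ↦ (2 * i + 1)!) x).sub
    (hasDerivAt_sin x)).const_mul ((-1) ^ n)).congr_deriv ?_
  unfold cosRemainder
  congr 2
  refine Finset.sum_congr rfl fun i _ ↦ ?_
  rw [Nat.factorial_succ]
  push_cast
  field_simp

theorem hasDerivAt_cosRemainder_succ (n : ℕ) (x : ℝ) :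
    HasDerivAt (cosRemainder (n + 1)) (sinRemainder n x) x := by
  have hterm (i : ℕ) : HasDerivAt
      (fun x : ℝ ↦ (-1) ^ (i + 1) * x ^ (2 * (i + 1)) / (2 * (i + 1))!)
      (-((-1) ^ i * x ^ (2 * i + 1) / (2 * i + 1)!)) x := by
    refine (((hasDerivAt_pow _ x).const_mul _).div_const _).congr_deriv ?_
    rw [show 2 * (i + 1) = 2 * i + 1 + 1 by ring, Nat.factorial_succ (2 * i + 1)]
    push_cast
    field_simp
    ring
  unfold cosRemainder sinRemainder
  simp_rw [Finset.sum_range_succ' _ (n + 1), mul_zero, pow_zero]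
  refine ((((HasDerivAt.fun_sum fun i _ ↦ hterm i).add_const _).fun_sub
    (hasDerivAt_cos x)).const_mul _).congr_deriv ?_
  rw [Finset.sum_neg_distrib]
  ring

theorem cosRemainder_zero_right (n : ℕ) : cosRemainder n 0 = 0 := by
  simp [cosRemainder, Finset.sum_range_succ']

theorem sinRemainder_zero_right (n : ℕ) : sinRemainder n 0 = 0 := by
  simp [sinRemainder]

theorem cosRemainder_nonneg (n : ℕ) {x : ℝ} (hx : 0 ≤ x) : 0 ≤ cosRemainder n x := by
  induction n generalizing x with
  | zero => simp [cosRemainder, cos_le_one]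
  | succ n ih =>
    have hsin {x : ℝ} (hx : 0 ≤ x) : 0 ≤ sinRemainder n x :=
      nonneg_of_hasDerivAt_nonneg (sinRemainder_zero_right n) (hasDerivAt_sinRemainder n)
        (fun _ ↦ ih) hx
    exact nonneg_of_hasDerivAt_nonneg (cosRemainder_zero_right (n + 1))
      (hasDerivAt_cosRemainder_succ n) (fun _ ↦ hsin) hx

theorem sinRemainder_nonneg (n : ℕ) {x : ℝ} (hx : 0 ≤ x) : 0 ≤ sinRemainder n x :=
  nonneg_of_hasDerivAt_nonneg (sinRemainder_zero_right n) (hasDerivAt_sinRemainder n)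
    (fun _ ↦ cosRemainder_nonneg n) hx

theorem sineIntegral_taylor_remainder_nonneg (n : ℕ) {x : ℝ} (hx : 0 ≤ x) :
    0 ≤ (-1) ^ n * (∑ i ∈ Finset.range (n + 1),
      (-1) ^ i * x ^ (2 * i + 1) / ((2 * i + 1) * (2 * i + 1)!) - sineIntegral x) := by
  refine nonneg_of_hasDerivAt_nonneg
    (g := fun x ↦ (-1) ^ n * (∑ i ∈ Finset.range (n + 1),
      (-1) ^ i * x ^ (2 * i + 1) / ((2 * i + 1) * (2 * i + 1)!) - sineIntegral x))
    (by simp [sineIntegral_zero])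
    (fun x ↦ ((hasDerivAt_sum_alternating _ _ x).sub (hasDerivAt_sineIntegral x)).const_mul _)
    (fun x hx ↦ ?_) hx
  rcases hx.eq_or_lt with rfl | hx
  · simp [Finset.sum_range_succ']
  · refine (div_nonneg (sinRemainder_nonneg n hx.le) hx.le).trans_eq ?_
    rw [sinRemainder, sinc_of_ne_zero hx.ne', mul_div_assoc, sub_div, Finset.sum_div]
    congr 2
    refine Finset.sum_congr rfl fun i _ ↦ ?_
    field_simp
    ring

theorem sineIntegral_pi_le : sineIntegral π ≤ 0.6 * π := by
  have htaylor : sineIntegral π ≤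
      π * (1 - π ^ 2 / 18 + π ^ 4 / 600 - π ^ 6 / 35280 + π ^ 8 / 3265920) := by
    have h := sineIntegral_taylor_remainder_nonneg 4 pi_nonneg
    norm_num [Finset.sum_range_succ, Nat.factorial] at h
    linarith
  have hπ := pi_gt_d4
  have hπ' := pi_lt_d4
  have h2 : π ^ 2 ≤ 9.8697 := by nlinarith
  have h2' : 9.869 ≤ π ^ 2 := by nlinarith
  have h4 : π ^ 4 ≤ 97.411 := by nlinarith
  have h6 : 961 ≤ π ^ 6 := by nlinarith
  have h8 : π ^ 8 ≤ 9489 := by nlinarith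
  refine htaylor.trans ?_
  rw [mul_comm 0.6 π]
  gcongr
  linarith

theorem sinc_nonneg {x : ℝ} (hx : 0 ≤ x) (hxπ : x ≤ π) : 0 ≤ sinc x := by
  rcases hx.eq_or_lt with rfl | hx
  · simp
  · rw [sinc_of_ne_zero hx.ne']
    exact div_nonneg (sin_nonneg_of_nonneg_of_le_pi hx.le hxπ) hx.le

theorem sinc_nonpos {x : ℝ} (hπx : π ≤ x) (hx : x ≤ 2 * π) : sinc x ≤ 0 := by
  have hpos : 0 < x := pi_pos.trans_le hπx
  rw [sinc_of_ne_zero hpos.ne', ← neg_nonneg, ← neg_div, ← sin_sub_pi]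
  exact div_nonneg (sin_nonneg_of_nonneg_of_le_pi (by linarith) (by linarith)) hpos.le

theorem continuous_sineIntegral : Continuous sineIntegral :=
  continuous_iff_continuousAt.2 fun x ↦ (hasDerivAt_sineIntegral x).continuousAt

theorem monotoneOn_sineIntegral : MonotoneOn sineIntegral (Icc 0 π) :=
  monotoneOn_of_hasDerivWithinAt_nonneg (convex_Icc 0 π) continuous_sineIntegral.continuousOn
    (fun x _ ↦ (hasDerivAt_sineIntegral x).hasDerivWithinAt)
    fun _ hx ↦ sinc_nonneg (interior_subset hx).1 (interior_subset hx).2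

theorem antitoneOn_sineIntegral : AntitoneOn sineIntegral (Icc π (2 * π)) :=
  antitoneOn_of_hasDerivWithinAt_nonpos (convex_Icc π (2 * π))
    continuous_sineIntegral.continuousOn
    (fun x _ ↦ (hasDerivAt_sineIntegral x).hasDerivWithinAt)
    fun _ hx ↦ sinc_nonpos (interior_subset hx).1 (interior_subset hx).2

theorem sineIntegral_le {x : ℝ} (hx : 0 ≤ x) : sineIntegral x ≤ 0.6 * π := by
  rcases le_total x π with hπ | hπ
  · exact (monotoneOn_sineIntegral ⟨hx, hπ⟩ ⟨pi_nonneg, le_rfl⟩ hπ).trans sineIntegral_pi_le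
  rcases le_total x (2 * π) with h2π | h2π
  · exact (antitoneOn_sineIntegral ⟨le_rfl, by linarith⟩ ⟨hπ, h2π⟩ hπ).trans sineIntegral_pi_le
  · have h3 := pi_gt_three
    have hdirichlet := (abs_le.1 (abs_sineIntegral_sub_pi_div_two_le (by linarith : 0 < x))).2
    have hinv : 1 / x ≤ 1 / 6 := by gcongr; linarith
    linarith

theorem sineIntegral_nonneg {x : ℝ} (hx : 0 ≤ x) : 0 ≤ sineIntegral x := by
  rcases le_total x π with hπ | hπ
  · exact sineIntegral_zero ▸ monotoneOn_sineIntegral ⟨le_rfl, pi_nonneg⟩ ⟨hx, hπ⟩ hx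
  · have h3 := pi_gt_three
    have hdirichlet := (abs_le.1 (abs_sineIntegral_sub_pi_div_two_le (by linarith : 0 < x))).1
    have hinv : 1 / x ≤ 1 / 3 := by gcongr; linarith
    linarith

theorem abs_sineIntegral_le (x : ℝ) : |sineIntegral x| ≤ 0.6 * π := by
  rcases le_total 0 x with hx | hx
  · exact (abs_of_nonneg (sineIntegral_nonneg hx)).trans_le (sineIntegral_le hx)
  · have hx' : 0 ≤ -x := neg_nonneg.2 hx
    rw [← abs_neg, ← sineIntegral_neg]
    exact (abs_of_nonneg (sineIntegral_nonneg hx')).trans_le (sineIntegral_le hx')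

theorem abs_J_le (k : ℤ) {h : ℝ} (hh : 0 ≤ h) (x : ℝ) : |J k h x| ≤ 1.1 * h := by
  set y := π * (x / h - k)
  have hSi : |1 / π * sineIntegral y| ≤ 0.6 := by
    rw [abs_mul, abs_of_pos (by positivity : 0 < 1 / π), one_div, inv_mul_le_iff₀ pi_pos]
    linarith [abs_sineIntegral_le y]
  have hfactor : |1 / 2 + 1 / π * sineIntegral y| ≤ 1.1 := by
    rw [abs_le] at hSi ⊢
    constructor <;> linarith
  calc |J k h x| = |1 / 2 + 1 / π * sineIntegral y| * h := by
        rw [J, abs_mul, abs_of_nonneg hh, mul_comm]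
    _ ≤ 1.1 * h := by gcongr

theorem tendsto_sineIntegral_atTop : Tendsto sineIntegral atTop (𝓝 (π / 2)) := by
  rw [tendsto_iff_norm_sub_tendsto_zero]
  refine squeeze_zero' (.of_forall fun _ ↦ norm_nonneg _) ?_
    (tendsto_inv_atTop_zero (𝕜 := ℝ))
  filter_upwards [eventually_gt_atTop 0] with x hx
  simpa using abs_sineIntegral_sub_pi_div_two_le hx

theorem tendsto_sineIntegral_atBot : Tendsto sineIntegral atBot (𝓝 (-(π / 2))) :=
  (tendsto_sineIntegral_atTop.comp tendsto_neg_atBot_atTop).neg.congr fun x ↦ by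
    simp [sineIntegral_neg]

theorem tendsto_J_atBot (k : ℤ) {h : ℝ} (hh : 0 < h) : Tendsto (J k h) atBot (𝓝 0) := by
  have harg : Tendsto (fun x : ℝ ↦ π * (x / h - k)) atBot atBot :=
    (tendsto_atBot_add_const_right _ _ (tendsto_id.atBot_div_const hh)).const_mul_atBot pi_pos
  have hJ := (((tendsto_sineIntegral_atBot.comp harg).const_mul (1 / π)).const_add
    (1 / 2)).const_mul h
  have hzero : h * (1 / 2 + 1 / π * -(π / 2)) = 0 := by
    field_simp
    ring
  rwa [hzero] at hJ

theorem hasDerivAt_J (k : ℤ) {h : ℝ} (hh : h ≠ 0) (x : ℝ) :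
    HasDerivAt (J k h) (sinc (π * (x / h - k))) x := by
  have harg : HasDerivAt (fun x : ℝ ↦ π * (x / h - k)) (π * (1 / h)) x :=
    (((hasDerivAt_id x).div_const h).sub_const _).const_mul π
  have hSi := (hasDerivAt_sineIntegral (π * (x / h - k))).comp x harg
  refine (((hSi.const_mul (1 / π)).const_add (1 / 2)).const_mul h).congr_deriv ?_
  field_simp

theorem integral_sinc_eq_J_sub (k : ℤ) {h : ℝ} (hh : h ≠ 0) (a b : ℝ) :
    ∫ s in a..b, sinc (π * (s / h - k)) = J k h b - J k h a :=
  intervalIntegral.integral_eq_sub_of_hasDerivAt (fun x _ ↦ hasDerivAt_J k hh x)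
    (Continuous.intervalIntegrable (by fun_prop) _ _)

section PartialFractions

variable {x y : ℂ}

theorem sub_intCast_ne_zero (hx : x ∈ Complex.integerComplement) (k : ℤ) : x - k ≠ 0 :=
  fun h ↦ hx ⟨k, (sub_eq_zero.1 h).symm⟩

theorem half_mem_integerComplement (hx : x ∈ Complex.integerComplement) :
    x / 2 ∈ Complex.integerComplement := by
  rintro ⟨k, hk⟩
  exact hx ⟨2 * k, by push_cast; rw [hk]; ring⟩

theorem summable_inv_sub_inv (hx : x ∈ Complex.integerComplement)
    (hy : y ∈ Complex.integerComplement) :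
    Summable fun k : ℤ ↦ 1 / (x - k) - 1 / (y - k) := by
  have hprod : Summable fun k : ℤ ↦ (y - x) * ((-x + k) * (-y + k) : ℂ)⁻¹ := by
    apply Summable.mul_left
    apply EisensteinSeries.summable_inv_of_isBigO_rpow_inv (a := 2) (by norm_num)
    simpa [pow_two, mul_comm] using (EisensteinSeries.linear_inv_isBigO_right 1 (-x)).mul
      (EisensteinSeries.linear_inv_isBigO_right 1 (-y))
  refine hprod.congr fun k ↦ ?_
  have hxk := sub_intCast_ne_zero hx k
  have hyk := sub_intCast_ne_zero hy k
  rw [show -x + k = -(x - k) by ring, show -y + k = -(y - k) by ring]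
  field_simp
  ring

/-- The Mittag-Leffler expansion of the cotangent; taking a difference makes it absolutely
convergent over `ℤ`. -/
theorem hasSum_inv_sub_inv (hx : x ∈ Complex.integerComplement)
    (hy : y ∈ Complex.integerComplement) :
    HasSum (fun k : ℤ ↦ 1 / (x - k) - 1 / (y - k))
      (π * Complex.cot (π * x) - π * Complex.cot (π * y)) := by
  have hsum := summable_inv_sub_inv hx hy
  have hpos : Summable fun n : ℕ ↦ 1 / (x - ((n : ℤ) + 1 : ℤ)) - 1 / (y - ((n : ℤ) + 1 : ℤ)) :=
    hsum.comp_injective (i := fun n : ℕ ↦ (n : ℤ) + 1) fun a b h ↦ by simpa using h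
  have hneg : Summable fun n : ℕ ↦
      1 / (x - (-((n : ℤ) + 1) : ℤ)) - 1 / (y - (-((n : ℤ) + 1) : ℤ)) :=
    hsum.comp_injective (i := fun n : ℕ ↦ -((n : ℤ) + 1)) fun a b h ↦ by simpa using h
  have hpair (n : ℕ) : (1 / (x - ((n : ℤ) + 1 : ℤ)) - 1 / (y - ((n : ℤ) + 1 : ℤ))) +
      (1 / (x - (-((n : ℤ) + 1) : ℤ)) - 1 / (y - (-((n : ℤ) + 1) : ℤ))) =
        cotTerm x n - cotTerm y n := by
    unfold cotTerm
    push_cast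
    simp only [sub_neg_eq_add]
    ring
  have htsum : ∑' k : ℤ, (1 / (x - k) - 1 / (y - k)) =
      π * Complex.cot (π * x) - π * Complex.cot (π * y) := by
    rw [tsum_of_add_one_of_neg_add_one (f := fun k : ℤ ↦ 1 / (x - k) - 1 / (y - k)) hpos hneg,
      add_right_comm, ← hpos.tsum_add hneg]
    simp_rw [hpair]
    rw [(summable_cotTerm hx).tsum_sub (summable_cotTerm hy)]
    unfold cotTerm
    rw [← cot_series_rep' hx, ← cot_series_rep' hy]
    simp only [Int.cast_zero, sub_zero]
    ring
  exact htsum ▸ hsum.hasSum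

theorem cot_half_sub_cot {w : ℂ} (hw : Complex.sin w ≠ 0) :
    Complex.cot (w / 2) - Complex.cot w = 1 / Complex.sin w := by
  have hsin : Complex.sin w = 2 * Complex.sin (w / 2) * Complex.cos (w / 2) := by
    rw [← Complex.sin_two_mul, mul_div_cancel₀ w two_ne_zero]
  have hcos : Complex.cos w = 2 * Complex.cos (w / 2) ^ 2 - 1 := by
    rw [← Complex.cos_two_mul, mul_div_cancel₀ w two_ne_zero]
  have hsin' : Complex.sin (w / 2) ≠ 0 := fun h ↦ hw (by rw [hsin, h]; ring)
  have hcos' : Complex.cos (w / 2) ≠ 0 := fun h ↦ hw (by rw [hsin, h]; ring)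
  rw [Complex.cot, Complex.cot, hsin, hcos]
  field_simp
  ring

theorem hasSum_even_inv_sub_inv (hx : x ∈ Complex.integerComplement)
    (hy : y ∈ Complex.integerComplement) :
    HasSum (fun k : ℤ ↦ (1 + (-1 : ℂ) ^ k) * (1 / (x - k) - 1 / (y - k)))
      (π * Complex.cot (π * (x / 2)) - π * Complex.cot (π * (y / 2))) := by
  have hinj : Function.Injective fun k : ℤ ↦ 2 * k := fun a b h ↦ by simpa using h
  rw [← hinj.hasSum_iff]
  · refine (hasSum_inv_sub_inv (half_mem_integerComplement hx)
      (half_mem_integerComplement hy)).congr_fun fun k ↦ ?_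
    have hxk : x / 2 - k = (x - (2 * k : ℤ)) / 2 := by push_cast; ring
    have hyk : y / 2 - k = (y - (2 * k : ℤ)) / 2 := by push_cast; ring
    simp only [Function.comp_apply, (even_two_mul k).neg_one_zpow]
    rw [hxk, hyk, one_div_div, one_div_div]
    ring
  · intro k hk
    have hodd : Odd k := by
      rw [← Int.not_even_iff_odd]
      rintro ⟨m, hm⟩
      exact hk ⟨m, by simp only [hm]; ring⟩
    rw [hodd.neg_one_zpow]
    ring

theorem hasSum_neg_one_zpow_mul_inv_sub_inv (hx : x ∈ Complex.integerComplement)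
    (hy : y ∈ Complex.integerComplement) :
    HasSum (fun k : ℤ ↦ (-1 : ℂ) ^ k * (1 / (x - k) - 1 / (y - k)))
      (π / Complex.sin (π * x) - π / Complex.sin (π * y)) := by
  have hvalue : π / Complex.sin (π * x) - π / Complex.sin (π * y) =
      π * Complex.cot (π * (x / 2)) - π * Complex.cot (π * (y / 2)) -
        (π * Complex.cot (π * x) - π * Complex.cot (π * y)) := by
    rw [← mul_div_assoc, ← mul_div_assoc]
    linear_combination (-π : ℂ) * cot_half_sub_cot (sin_pi_mul_ne_zero hx) +
      (π : ℂ) * cot_half_sub_cot (sin_pi_mul_ne_zero hy)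
  rw [hvalue]
  exact ((hasSum_even_inv_sub_inv hx hy).sub (hasSum_inv_sub_inv hx hy)).congr_fun
    fun k ↦ by ring

end PartialFractions

theorem sinc_pi_mul_sub_intCast {y : ℝ} {k : ℤ} (hk : y ≠ k) :
    sinc (π * (y - k)) = (-1) ^ k * sin (π * y) / (π * (y - k)) := by
  rw [sinc_of_ne_zero (mul_ne_zero pi_ne_zero (sub_ne_zero.2 hk)), mul_sub, mul_comm π (k : ℝ),
    sin_sub_int_mul_pi]

theorem sinc_pi_mul_intCast_sub (m k : ℤ) :
    sinc (π * ((m : ℝ) - k)) = if k = m then 1 else 0 := by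
  split_ifs with h
  · simp [h]
  · rw [sinc_pi_mul_sub_intCast (by exact_mod_cast Ne.symm h), mul_comm π (m : ℝ), sin_int_mul_pi]
    simp

theorem hasSum_sinc_div (y : ℝ) {w : ℂ} (hw : w.im ≠ 0) :
    HasSum (fun k : ℤ ↦ (sinc (π * (y - k)) : ℂ) / (w - k))
      ((1 - Complex.sin (π * y) / Complex.sin (π * w)) / (w - y)) := by
  have hw' : w ∈ Complex.integerComplement := by
    rintro ⟨k, rfl⟩
    simp at hw
  have hwy : w - y ≠ 0 := fun h0 ↦ hw (by rw [sub_eq_zero.1 h0, Complex.ofReal_im])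
  by_cases hy : (y : ℂ) ∈ Complex.integerComplement
  · have hsin_y := sin_pi_mul_ne_zero hy
    have hsin_w := sin_pi_mul_ne_zero hw'
    have hπ : (π : ℂ) ≠ 0 := by exact_mod_cast pi_ne_zero
    have hvalue : (1 - Complex.sin (π * y) / Complex.sin (π * w)) / (w - y) =
        Complex.sin (π * y) / (π * (w - y)) *
          (π / Complex.sin (π * y) - π / Complex.sin (π * w)) := by
      field_simp
    rw [hvalue]
    refine ((hasSum_neg_one_zpow_mul_inv_sub_inv hy hw').mul_left _).congr_fun fun k ↦ ?_
    have hyk := sub_intCast_ne_zero hy k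
    have hwk := sub_intCast_ne_zero hw' k
    rw [sinc_pi_mul_sub_intCast fun h ↦ hy ⟨k, by simp [h]⟩]
    push_cast
    generalize Complex.sin (π * y) = t
    field_simp
    ring
  · obtain ⟨m, hm⟩ : ∃ m : ℤ, y = m := by
      simpa [Complex.integerComplement, eq_comm, ← Complex.ofReal_intCast] using hy
    subst hm
    have hsin : Complex.sin (π * m) = 0 := by rw [mul_comm, Complex.sin_int_mul_pi]
    rw [Complex.ofReal_intCast, hsin, zero_div, sub_zero]
    refine (hasSum_ite_eq m (1 / (w - m))).congr_fun fun k ↦ ?_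
    rw [sinc_pi_mul_intCast_sub]
    split_ifs with h <;> simp [h]

section CauchyFormula

/-- The Cauchy kernel `1 / (ζ - t)` at the point `ζ = x + iη` of a horizontal line. -/
noncomputable def cauchyKernel (η t x : ℝ) : ℂ := (x + η * I - t)⁻¹

theorem line_sub_ne_zero {η : ℝ} (hη : η ≠ 0) (t x : ℝ) : (x + η * I - t : ℂ) ≠ 0 := by
  intro h
  exact hη (by simpa using congrArg Complex.im h)

theorem continuous_cauchyKernel {η : ℝ} (hη : η ≠ 0) (t : ℝ) : Continuous (cauchyKernel η t) :=
  Continuous.inv₀ (by fun_prop) (line_sub_ne_zero hη t)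

theorem norm_cauchyKernel_le {η : ℝ} (hη : η ≠ 0) (t x : ℝ) : ‖cauchyKernel η t x‖ ≤ |η|⁻¹ := by
  rw [cauchyKernel, norm_inv]
  gcongr
  simpa using Complex.abs_im_le_norm (x + η * I - t)

theorem cauchyKernel_neg_sub_cauchyKernel {δ : ℝ} (hδ : δ ≠ 0) (t x : ℝ) :
    cauchyKernel (-δ) t x - cauchyKernel δ t x =
      (2 * I / δ) * ((1 + ((x - t) / δ) ^ 2)⁻¹ : ℝ) := by
  have hδ' : (δ : ℂ) ≠ 0 := by exact_mod_cast hδ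
  have : (1 + ((x - t) / δ) ^ 2 : ℂ) ≠ 0 := by
    exact_mod_cast (by positivity : (1 + ((x - t) / δ) ^ 2 : ℝ) ≠ 0)
  have hprod : (x + (-δ : ℝ) * I - t) * (x + δ * I - t) = δ ^ 2 * (1 + ((x - t) / δ) ^ 2 : ℂ) := by
    push_cast
    field_simp
    linear_combination (-(δ : ℂ) ^ 2) * Complex.I_sq
  rw [cauchyKernel, cauchyKernel, inv_sub_inv (line_sub_ne_zero (neg_ne_zero.2 hδ) t x)
    (line_sub_ne_zero hδ t x), hprod]
  push_cast
  field_simp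
  ring

theorem integrable_cauchyKernel_neg_sub {δ : ℝ} (hδ : δ ≠ 0) (t : ℝ) :
    Integrable fun x ↦ cauchyKernel (-δ) t x - cauchyKernel δ t x := by
  simp_rw [cauchyKernel_neg_sub_cauchyKernel hδ]
  exact (((integrable_inv_one_add_sq.comp_div hδ).comp_sub_right t).ofReal).const_mul _

theorem integral_cauchyKernel_neg_sub {δ : ℝ} (hδ : 0 < δ) (t : ℝ) :
    ∫ x, (cauchyKernel (-δ) t x - cauchyKernel δ t x) = 2 * π * I := by
  have hδ' : (δ : ℂ) ≠ 0 := by exact_mod_cast hδ.ne'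
  simp_rw [cauchyKernel_neg_sub_cauchyKernel hδ.ne']
  rw [integral_const_mul, integral_complex_ofReal,
    integral_sub_right_eq_self fun x : ℝ ↦ (1 + (x / δ) ^ 2)⁻¹,
    Measure.integral_comp_div fun x : ℝ ↦ (1 + x ^ 2)⁻¹, integral_univ_inv_one_add_sq,
    abs_of_pos hδ]
  simp only [smul_eq_mul, Complex.ofReal_mul]
  field_simp

variable {E : Type*}

/-- The restriction of `F` to the horizontal line `Im ζ = η`, parametrized by the real part. -/
def onLine (F : ℂ → E) (η : ℝ) (x : ℝ) : E := F (x + η * I)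

theorem onLine_zero (F : ℂ → E) : onLine F 0 = fun x : ℝ ↦ F x := by
  funext x
  rw [onLine, Complex.ofReal_zero, zero_mul, add_zero]

theorem onLine_re_im (F : ℂ → E) (z : ℂ) : onLine F z.im z.re = F z := by
  rw [onLine, Complex.re_add_im]

variable [NormedAddCommGroup E] [NormedSpace ℂ E]

/-- The contribution to Cauchy's formula at `t` of the line `Im ζ = η`, on which the integrand is
`g`. -/
noncomputable def cauchyTransform (g : ℝ → E) (η t : ℝ) : E := ∫ x, cauchyKernel η t x • g x

theorem integrable_cauchyKernel_smul {g : ℝ → E} (hg : Integrable g) {η : ℝ} (hη : η ≠ 0) (t : ℝ) :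
    Integrable fun x ↦ cauchyKernel η t x • g x :=
  hg.bdd_smul |η|⁻¹ (continuous_cauchyKernel hη t).aestronglyMeasurable
    (.of_forall (norm_cauchyKernel_le hη t))

theorem isOpen_strip (d : ℝ) : IsOpen (strip d) :=
  isOpen_lt (by fun_prop) continuous_const

theorem norm_integral_vertical_le {G : ℂ → E} {δ B σ : ℝ} (hδ : 0 ≤ δ)
    (hG : ∀ y : ℝ, |y| ≤ δ → ‖G (σ + y * I)‖ ≤ B) :
    ‖∫ y in (-δ)..δ, G (σ + y * I)‖ ≤ B * (2 * δ) := by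
  have h := intervalIntegral.norm_integral_le_of_norm_le_const (a := -δ) (b := δ)
    (f := fun y : ℝ ↦ G (σ + y * I)) (C := B) fun y hy ↦ by
      rw [uIoc_of_le (by linarith)] at hy
      exact hG y (abs_le.2 ⟨hy.1.le, hy.2⟩)
  rwa [show |δ - -δ| = 2 * δ by rw [abs_of_nonneg (by linarith)]; ring] at h

theorem integral_onLine_neg_sub_eq_vertical {G : ℂ → E} {δ d : ℝ} (hδ : 0 ≤ δ) (hδd : δ < d)
    (hG : DifferentiableOn ℂ G (strip d)) (T : ℝ) :
    ∫ x in (-T)..T, (onLine G (-δ) x - onLine G δ x) =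
      I • (∫ y in (-δ)..δ, G ((-T : ℝ) + y * I)) - I • ∫ y in (-δ)..δ, G (T + y * I) := by
  have hcont {η : ℝ} (hη : |η| < d) : Continuous (onLine G η) :=
    hG.continuousOn.comp_continuous (by fun_prop) fun x ↦ by simpa [strip] using hη
  have hrect := Complex.integral_boundary_rect_eq_zero_of_differentiableOn G ⟨-T, -δ⟩ ⟨T, δ⟩
    (hG.mono fun z hz ↦ by
      rw [Complex.mem_reProdIm] at hz
      have him := hz.2
      rw [uIcc_of_le (by simpa using hδ)] at him
      exact (abs_le.2 him).trans_lt hδd)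
  rw [intervalIntegral.integral_sub
    ((hcont (by simpa [abs_of_nonneg hδ] using hδd)).intervalIntegrable _ _)
    ((hcont (by simpa [abs_of_nonneg hδ] using hδd)).intervalIntegrable _ _)]
  exact eq_sub_of_add_eq (sub_eq_zero.1 hrect)

theorem integral_onLine_neg_sub_eq_zero [CompleteSpace E] {G : ℂ → E} {δ d : ℝ} {b : ℝ → ℝ}
    (hδ : 0 ≤ δ) (hδd : δ < d) (hG : DifferentiableOn ℂ G (strip d)) (hb : Tendsto b atTop (𝓝 0))
    (hGb : ∀ᶠ T in atTop, ∀ z : ℂ, |z.re| = T → |z.im| ≤ δ → ‖G z‖ ≤ b T)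
    (hint : Integrable fun x ↦ onLine G (-δ) x - onLine G δ x) :
    ∫ x, (onLine G (-δ) x - onLine G δ x) = 0 := by
  refine tendsto_nhds_unique
    (intervalIntegral_tendsto_integral hint tendsto_neg_atTop_atBot tendsto_id) ?_
  refine squeeze_zero_norm' (a := fun T ↦ b T * (2 * δ) + b T * (2 * δ)) ?_ ?_
  · filter_upwards [hGb, eventually_ge_atTop 0] with T hT hT0
    have hvert {σ : ℝ} (hσ : |σ| = T) : ‖∫ y in (-δ)..δ, G (σ + y * I)‖ ≤ b T * (2 * δ) :=
      norm_integral_vertical_le hδ fun y hy ↦ hT _ (by simpa using hσ) (by simpa using hy)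
    rw [id, integral_onLine_neg_sub_eq_vertical hδ hδd hG]
    refine (norm_sub_le _ _).trans ?_
    rw [norm_smul, norm_smul, Complex.norm_I, one_mul, one_mul]
    exact add_le_add (hvert (by simpa using hT0)) (hvert (by simpa using hT0))
  · simpa using (hb.mul_const (2 * δ)).add (hb.mul_const (2 * δ))

theorem onLine_dslope (F : ℂ → E) {η : ℝ} (hη : η ≠ 0) (t x : ℝ) :
    onLine (dslope F t) η x = cauchyKernel η t x • onLine F η x - cauchyKernel η t x • F t := by
  rw [onLine, dslope_of_ne _ (sub_ne_zero.1 (line_sub_ne_zero hη t x)), slope, vsub_eq_sub,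
    smul_sub, cauchyKernel, onLine]

theorem norm_dslope_le {F : ℂ → E} {C : ℝ} {z t : ℂ} {T : ℝ} (hz : ‖F z‖ ≤ C) (ht : ‖F t‖ ≤ C)
    (hT : 0 < T) (hzt : T ≤ ‖z - t‖) : ‖dslope F t z‖ ≤ 2 * C / T := by
  have hne : z ≠ t := sub_ne_zero.1 (norm_pos_iff.1 (hT.trans_le hzt))
  rw [dslope_of_ne _ hne, slope_def_module, norm_smul, norm_inv, inv_mul_eq_div]
  have hsub : ‖F z - F t‖ ≤ 2 * C := (norm_sub_le _ _).trans (by linarith)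
  have hC : 0 ≤ C := (norm_nonneg _).trans hz
  gcongr

/-- The hypotheses of Cauchy's formula over the two lines `Im ζ = ±δ` for a function holomorphic
in the larger `strip d`. -/
structure IsStripIntegrable (F : ℂ → E) (d δ : ℝ) : Prop where
  pos : 0 < δ
  lt : δ < d
  differentiableOn : DifferentiableOn ℂ F (strip d)
  bounded : ∃ C, ∀ z : ℂ, |z.im| ≤ δ → ‖F z‖ ≤ C
  integrable_neg : Integrable (onLine F (-δ))
  integrable : Integrable (onLine F δ)

theorem IsStripIntegrable.cauchyTransform_neg_sub [CompleteSpace E] {F : ℂ → E} {d δ : ℝ}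
    (hF : IsStripIntegrable F d δ) (t : ℝ) :
    cauchyTransform (onLine F (-δ)) (-δ) t - cauchyTransform (onLine F δ) δ t =
      (2 * π * I) • F t := by
  have hδ := hF.pos
  have hδ' : -δ ≠ 0 := neg_ne_zero.2 hδ.ne'
  obtain ⟨C, hC⟩ := hF.bounded
  have hmem : strip d ∈ 𝓝 (t : ℂ) :=
    (isOpen_strip d).mem_nhds (by simpa [strip] using hδ.trans hF.lt)
  have hsplit (x : ℝ) : onLine (dslope F t) (-δ) x - onLine (dslope F t) δ x =
      (cauchyKernel (-δ) t x • onLine F (-δ) x - cauchyKernel δ t x • onLine F δ x) -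
        (cauchyKernel (-δ) t x - cauchyKernel δ t x) • F t := by
    rw [onLine_dslope F hδ', onLine_dslope F hδ.ne', sub_smul]
    abel
  have hkernel := (integrable_cauchyKernel_neg_sub hδ.ne' t).smul_const (F t)
  have hF_neg := integrable_cauchyKernel_smul hF.integrable_neg hδ' t
  have hF_pos := integrable_cauchyKernel_smul hF.integrable hδ.ne' t
  have hF_sub : Integrable fun x ↦
      cauchyKernel (-δ) t x • onLine F (-δ) x - cauchyKernel δ t x • onLine F δ x :=
    hF_neg.sub hF_pos
  have hdecay : Tendsto (fun T ↦ 2 * C / (T - |t|)) atTop (𝓝 0) :=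
    (tendsto_atTop_add_const_right _ _ tendsto_id).const_div_atTop _
  have hzero : ∫ x, (onLine (dslope F t) (-δ) x - onLine (dslope F t) δ x) = 0 := by
    refine integral_onLine_neg_sub_eq_zero hδ.le hF.lt
      ((Complex.differentiableOn_dslope hmem).2 hF.differentiableOn) hdecay ?_ ?_
    · filter_upwards [eventually_gt_atTop |t|] with T hT z hzre hzim
      refine norm_dslope_le (hC z hzim) (hC t (by simpa using hδ.le)) (sub_pos.2 hT) ?_
      calc T - |t| ≤ |z.re - t| := hzre ▸ abs_sub_abs_le_abs_sub _ _
        _ ≤ ‖z - t‖ := by simpa using Complex.abs_re_le_norm (z - t)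
    · simp_rw [hsplit]
      exact hF_sub.sub hkernel
  simp_rw [hsplit] at hzero
  rw [integral_sub hF_sub hkernel, integral_sub hF_neg hF_pos, integral_smul_const,
    integral_cauchyKernel_neg_sub hδ, sub_eq_zero] at hzero
  exact hzero

end CauchyFormula

section Oscillatory

theorem sinh_le_norm_sin (z : ℂ) : sinh |z.im| ≤ ‖Complex.sin z‖ := by
  refine le_of_sq_le_sq ?_ (norm_nonneg _)
  have hsin : Complex.sin z =
      ((sin z.re * cosh z.im : ℝ) : ℂ) + ((cos z.re * sinh z.im : ℝ) : ℂ) * I := by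
    rw [Complex.sin_eq]
    push_cast
    rfl
  have habs : sinh |z.im| ^ 2 = sinh z.im ^ 2 := by
    rcases abs_choice z.im with h | h <;> simp [h]
  rw [hsin, ← Complex.normSq_eq_norm_sq, Complex.normSq_add_mul_I, habs, mul_pow, mul_pow,
    cosh_sq z.im]
  nlinarith [sq_nonneg (sin z.re), sin_sq_add_cos_sq z.re]

theorem inv_sqrt_one_add_sq_le (u : ℝ) : (√(1 + u ^ 2))⁻¹ ≤ π / 2 - arctan u := by
  rw [← one_div, ← cos_arctan, ← sin_pi_div_two_sub]
  exact sin_le (by linarith [arctan_lt_pi_div_two u])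

theorem norm_cauchyKernel_sq {η : ℝ} (hη : η ≠ 0) (t x : ℝ) :
    ‖cauchyKernel η t x‖ ^ 2 = |η|⁻¹ * (1 / (1 + ((t - x) / |η|) ^ 2) * (1 / |η|)) := by
  have hη' : |η| ≠ 0 := abs_ne_zero.2 hη
  have hnorm : ‖(x + η * I - t : ℂ)‖ ^ 2 = (x - t) ^ 2 + |η| ^ 2 := by
    rw [← Complex.normSq_eq_norm_sq, Complex.normSq_apply, sq_abs]
    simp only [Complex.sub_re, Complex.add_re, Complex.ofReal_re, Complex.mul_re, Complex.I_re,
      mul_zero, Complex.ofReal_im, Complex.I_im, mul_one, sub_self, add_zero, Complex.sub_im,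
      Complex.add_im, Complex.mul_im, zero_add, sub_zero]
    ring
  rw [cauchyKernel, norm_inv, inv_pow, hnorm]
  have : (x - t) ^ 2 + |η| ^ 2 ≠ 0 := by positivity
  field_simp
  ring

theorem norm_cauchyKernel_eq {η : ℝ} (hη : η ≠ 0) (t x : ℝ) :
    ‖cauchyKernel η t x‖ = |η|⁻¹ * (√(1 + ((t - x) / |η|) ^ 2))⁻¹ := by
  rw [← sqrt_sq (norm_nonneg _), norm_cauchyKernel_sq hη, sqrt_eq_iff_eq_sq (by positivity)
    (by positivity), mul_pow, inv_pow (√_), sq_sqrt (by positivity)]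
  ring

theorem norm_cauchyKernel_le_sub_arctan {η : ℝ} (hη : η ≠ 0) (t x : ℝ) :
    ‖cauchyKernel η t x‖ ≤ |η|⁻¹ * (π / 2 - arctan ((t - x) / |η|)) := by
  rw [norm_cauchyKernel_eq hη]
  gcongr
  exact inv_sqrt_one_add_sq_le _

theorem norm_cauchyKernel_le_add_arctan {η : ℝ} (hη : η ≠ 0) (t x : ℝ) :
    ‖cauchyKernel η t x‖ ≤ |η|⁻¹ * (π / 2 + arctan ((t - x) / |η|)) := by
  have h := inv_sqrt_one_add_sq_le (-((t - x) / |η|))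
  rw [neg_sq, arctan_neg, sub_neg_eq_add] at h
  rw [norm_cauchyKernel_eq hη]
  gcongr

theorem hasDerivAt_cauchyKernel {η : ℝ} (hη : η ≠ 0) (x t : ℝ) :
    HasDerivAt (fun t ↦ cauchyKernel η t x) (cauchyKernel η t x ^ 2) t := by
  have h : HasDerivAt (fun z : ℂ ↦ (x + η * I - z)⁻¹) ((x + η * I - t : ℂ)⁻¹ ^ 2) t := by
    refine (((hasDerivAt_id (t : ℂ)).const_sub _).inv (line_sub_ne_zero hη t x)).congr_deriv ?_
    simp
  exact h.comp_ofReal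

theorem continuous_cauchyKernel_left {η : ℝ} (hη : η ≠ 0) (x : ℝ) :
    Continuous fun t ↦ cauchyKernel η t x :=
  continuous_iff_continuousAt.2 fun t ↦ (hasDerivAt_cauchyKernel hη x t).continuousAt

theorem integral_norm_cauchyKernel_sq {η : ℝ} (hη : η ≠ 0) (x a b : ℝ) :
    ∫ t in a..b, ‖cauchyKernel η t x‖ ^ 2 =
      |η|⁻¹ * (arctan ((b - x) / |η|) - arctan ((a - x) / |η|)) := by
  rw [mul_sub, ← intervalIntegral.integral_eq_sub_of_hasDerivAt
    (f := fun t ↦ |η|⁻¹ * arctan ((t - x) / |η|)) (f' := fun t ↦ ‖cauchyKernel η t x‖ ^ 2)]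
  · intro t _
    rw [norm_cauchyKernel_sq hη]
    exact ((((hasDerivAt_id t).sub_const x).div_const |η|).arctan).const_mul |η|⁻¹
  · exact ((continuous_cauchyKernel_left hη x).norm.pow 2).intervalIntegrable _ _

theorem norm_integral_mul_deriv_le {u v u' v' : ℝ → ℂ} {a b B : ℝ} (hab : a ≤ b)
    (hu : ∀ s, HasDerivAt u (u' s) s) (hv : ∀ s, HasDerivAt v (v' s) s) (hu' : Continuous u')
    (hv' : Continuous v') (hB : ∀ s, ‖v s‖ ≤ B) :
    ‖∫ s in a..b, u s * v' s‖ ≤ B * (‖u a‖ + ‖u b‖ + ∫ s in a..b, ‖u' s‖) := by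
  have hendpoint (s : ℝ) : ‖u s * v s‖ ≤ B * ‖u s‖ := by
    rw [norm_mul, mul_comm]
    gcongr
    exact hB s
  have hinterior : ‖∫ s in a..b, u' s * v s‖ ≤ B * ∫ s in a..b, ‖u' s‖ := by
    rw [← intervalIntegral.integral_const_mul]
    refine intervalIntegral.norm_integral_le_of_norm_le hab (.of_forall fun s _ ↦ ?_)
      ((hu'.norm.const_mul B).intervalIntegrable _ _)
    rw [norm_mul, mul_comm]
    gcongr
    exact hB s
  rw [intervalIntegral.integral_mul_deriv_eq_deriv_mul (fun s _ ↦ hu s) (fun s _ ↦ hv s)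
    (hu'.intervalIntegrable _ _) (hv'.intervalIntegrable _ _)]
  calc _ ≤ ‖u b * v b‖ + ‖u a * v a‖ + ‖∫ s in a..b, u' s * v s‖ :=
        (norm_sub_le _ _).trans (by gcongr; exact norm_sub_le _ _)
    _ ≤ B * ‖u b‖ + B * ‖u a‖ + B * ∫ s in a..b, ‖u' s‖ := by
        gcongr
        exacts [hendpoint b, hendpoint a]
    _ = _ := by ring

/-- The endpoint terms of the integration by parts are controlled by the missing parts of the
total `arctan` variation, so the bound does not depend on the interval. -/
theorem norm_integral_cauchyKernel_mul_sin_le {ω η a b : ℝ} (hω : 0 < ω) (hη : η ≠ 0)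
    (hab : a ≤ b) (x : ℝ) :
    ‖∫ s in a..b, cauchyKernel η s x * (sin (ω * s) : ℂ)‖ ≤ π / (ω * |η|) := by
  have : 0 < |η| := abs_pos.2 hη
  have hcos (s : ℝ) :
      HasDerivAt (fun s : ℝ ↦ ((-cos (ω * s) / ω : ℝ) : ℂ)) (sin (ω * s) : ℂ) s := by
    refine HasDerivAt.ofReal_comp ?_
    refine ((((hasDerivAt_id s).const_mul ω).cos).neg.div_const ω).congr_deriv ?_
    simp only [id, mul_one, neg_mul, neg_neg]
    field_simp
  have hcos_le (s : ℝ) : ‖((-cos (ω * s) / ω : ℝ) : ℂ)‖ ≤ 1 / ω := by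
    rw [Complex.norm_real, norm_div, norm_neg, Real.norm_of_nonneg hω.le]
    gcongr
    exact abs_cos_le_one _
  have hparts := norm_integral_mul_deriv_le hab (hasDerivAt_cauchyKernel hη x) hcos
    ((continuous_cauchyKernel_left hη x).pow 2) (by fun_prop) hcos_le
  simp_rw [norm_pow] at hparts
  rw [integral_norm_cauchyKernel_sq hη] at hparts
  calc _ ≤ _ := hparts
    _ ≤ 1 / ω * (|η|⁻¹ * (π / 2 + arctan ((a - x) / |η|)) +
          |η|⁻¹ * (π / 2 - arctan ((b - x) / |η|)) +
          |η|⁻¹ * (arctan ((b - x) / |η|) - arctan ((a - x) / |η|))) := by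
        gcongr
        exacts [norm_cauchyKernel_le_add_arctan hη a x, norm_cauchyKernel_le_sub_arctan hη b x]
    _ = π / (ω * |η|) := by
        field_simp
        ring

end Oscillatory

section Interpolation

theorem summable_inv_one_add_abs_sq : Summable fun j : ℤ ↦ (1 + |(j : ℝ)|)⁻¹ ^ 2 := by
  have hnat : Summable fun n : ℕ ↦ (1 + |(n : ℝ)|)⁻¹ ^ 2 := by
    have h := (summable_nat_add_iff 1).2 (Real.summable_nat_pow_inv.2 one_lt_two)
    refine h.congr fun n ↦ ?_
    rw [abs_of_nonneg n.cast_nonneg, inv_pow, add_comm 1]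
    push_cast
    rfl
  exact Summable.of_nat_of_neg (by simpa using hnat) (by simpa using hnat)

theorem inv_one_add_abs_sub_intCast_le (y : ℝ) (k : ℤ) :
    (1 + |y - k|)⁻¹ ≤ 2 * (1 + |((k - round y : ℤ) : ℝ)|)⁻¹ := by
  have h : |((k - round y : ℤ) : ℝ)| ≤ |y - k| + 1 / 2 := by
    rw [Int.cast_sub]
    calc |(k : ℝ) - round y| ≤ |k - y| + |y - round y| := abs_sub_le _ _ _
      _ ≤ |y - k| + 1 / 2 := by
        rw [abs_sub_comm (k : ℝ) y]
        gcongr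
        exact abs_sub_round y
  rw [← div_eq_mul_inv, inv_eq_one_div, div_le_div_iff₀ (by positivity) (by positivity)]
  linarith [abs_nonneg (y - k)]

theorem abs_sinc_pi_mul_le (z : ℝ) : |sinc (π * z)| ≤ 2 * (1 + |z|)⁻¹ := by
  rw [← div_eq_mul_inv, le_div_iff₀ (by positivity), mul_add, mul_one, ← one_add_one_eq_two]
  have hz : |sinc (π * z)| * |z| ≤ 1 := by
    rcases eq_or_ne z 0 with rfl | hz0
    · simp
    have hπz : |π * z| ≠ 0 := abs_ne_zero.2 (mul_ne_zero pi_ne_zero hz0)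
    have hsin : |sinc (π * z)| * |π * z| ≤ 1 := by
      rw [sinc_of_ne_zero (abs_ne_zero.1 hπz), abs_div, div_mul_cancel₀ _ hπz]
      exact abs_sin_le_one _
    refine le_trans ?_ hsin
    rw [abs_mul, abs_of_pos pi_pos]
    gcongr
    exact le_mul_of_one_le_left (abs_nonneg z) (by linarith [pi_gt_three])
  exact add_le_add (abs_sinc_le_one _) hz

theorem inv_norm_sub_intCast_le {w : ℂ} (hw : w.im ≠ 0) (k : ℤ) :
    ‖w - k‖⁻¹ ≤ (1 + |w.im|⁻¹) * (1 + |w.re - k|)⁻¹ := by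
  have him : |w.im| ≤ ‖w - k‖ := by simpa using Complex.abs_im_le_norm (w - k)
  have hre : |w.re - k| ≤ ‖w - k‖ := by simpa using Complex.abs_re_le_norm (w - k)
  have hw' : 0 < |w.im| := abs_pos.2 hw
  have hone : 1 ≤ |w.im|⁻¹ * ‖w - k‖ := by
    rw [inv_mul_eq_div, one_le_div hw']
    exact him
  rw [← div_eq_mul_inv, inv_eq_one_div, div_le_div_iff₀ (hw'.trans_le him) (by positivity)]
  linarith

theorem norm_sinc_div_le (y : ℝ) {w : ℂ} (hw : w.im ≠ 0) (k : ℤ) :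
    ‖(sinc (π * (y - k)) : ℂ) / (w - k)‖ ≤ 4 * (1 + |w.im|⁻¹) *
      ((1 + |((k - round y : ℤ) : ℝ)|)⁻¹ ^ 2 + (1 + |((k - round w.re : ℤ) : ℝ)|)⁻¹ ^ 2) := by
  set p := (1 + |((k - round y : ℤ) : ℝ)|)⁻¹
  set q := (1 + |((k - round w.re : ℤ) : ℝ)|)⁻¹
  calc ‖(sinc (π * (y - k)) : ℂ) / (w - k)‖
      = |sinc (π * (y - k))| * ‖w - k‖⁻¹ := by
        rw [norm_div, Complex.norm_real, norm_eq_abs, div_eq_mul_inv]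
    _ ≤ 2 * (2 * p) * ((1 + |w.im|⁻¹) * (2 * q)) := by
        gcongr
        · exact (abs_sinc_pi_mul_le _).trans
            (by gcongr; exact inv_one_add_abs_sub_intCast_le y k)
        · exact (inv_norm_sub_intCast_le hw k).trans
            (by gcongr; exact inv_one_add_abs_sub_intCast_le w.re k)
    _ = 4 * (1 + |w.im|⁻¹) * (2 * p * q) := by ring
    _ ≤ _ := by
        gcongr
        exact two_mul_le_add_sq p q

variable {E : Type*} [NormedAddCommGroup E] [NormedSpace ℂ E]

/-- The defect of sinc interpolation, with mesh `h`, of the Cauchy kernel with pole `x + iη`. -/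
noncomputable def remainderKernel (η h s x : ℝ) : ℂ :=
  cauchyKernel η s x * sin (π / h * s) * (Complex.sin (π / h * (x + η * I)))⁻¹

theorem sinc_mul_cauchyKernel_eq (η : ℝ) {h : ℝ} (hh : h ≠ 0) (s x : ℝ) (k : ℤ) :
    sinc (π * (s / h - k)) * cauchyKernel η (k * h) x =
      (h : ℂ)⁻¹ * ((sinc (π * ((s / h : ℝ) - k)) : ℂ) / ((x + η * I) / h - k)) := by
  have hh' : (h : ℂ) ≠ 0 := by exact_mod_cast hh
  rw [cauchyKernel, show (x + η * I - (k * h : ℝ) : ℂ) = h * ((x + η * I) / h - k) by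
    push_cast
    field_simp, mul_inv]
  ring

theorem im_line_div (η x h : ℝ) : ((x + η * I) / h : ℂ).im = η / h := by
  rw [Complex.div_ofReal_im]
  simp

theorem hasSum_sinc_mul_cauchyKernel {η h : ℝ} (hη : η ≠ 0) (hh : h ≠ 0) (s x : ℝ) :
    HasSum (fun k : ℤ ↦ sinc (π * (s / h - k)) * cauchyKernel η (k * h) x)
      (cauchyKernel η s x - remainderKernel η h s x) := by
  have hh' : (h : ℂ) ≠ 0 := by exact_mod_cast hh
  have him : ((x + η * I) / h : ℂ).im ≠ 0 := im_line_div η x h ▸ div_ne_zero hη hh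
  have hvalue : cauchyKernel η s x - remainderKernel η h s x = (h : ℂ)⁻¹ *
      ((1 - Complex.sin (π * (s / h : ℝ)) / Complex.sin (π * ((x + η * I) / h))) /
        ((x + η * I) / h - (s / h : ℝ))) := by
    rw [show ((x + η * I) / h - (s / h : ℝ) : ℂ) = (h : ℂ)⁻¹ * (x + η * I - s) by
      push_cast
      ring, remainderKernel, cauchyKernel, div_mul_eq_mul_div, ← mul_div_assoc]
    push_cast
    rw [div_mul_eq_mul_div, ← mul_div_assoc]
    have := line_sub_ne_zero hη s x
    field_simp
  rw [hvalue]
  simp_rw [sinc_mul_cauchyKernel_eq η hh]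
  exact (hasSum_sinc_div (s / h) him).mul_left _

theorem norm_sinc_mul_cauchyKernel_le {η h : ℝ} (hη : η ≠ 0) (hh : h ≠ 0) (s x : ℝ) (k : ℤ) :
    ‖sinc (π * (s / h - k)) * cauchyKernel η (k * h) x‖ ≤ |h|⁻¹ * (4 * (1 + |η / h|⁻¹)) *
      ((1 + |((k - round (s / h) : ℤ) : ℝ)|)⁻¹ ^ 2 +
        (1 + |((k - round ((x + η * I) / h : ℂ).re : ℤ) : ℝ)|)⁻¹ ^ 2) := by
  have him := im_line_div η x h
  rw [sinc_mul_cauchyKernel_eq η hh, norm_mul, norm_inv, Complex.norm_real, norm_eq_abs,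
    mul_assoc]
  gcongr
  rw [← him]
  exact norm_sinc_div_le _ (him ▸ div_ne_zero hη hh) k

theorem sinh_le_norm_sin_line (η h x : ℝ) :
    sinh |π / h * η| ≤ ‖Complex.sin (π / h * (x + η * I))‖ := by
  have him : (π / h * (x + η * I) : ℂ).im = π / h * η := by
    rw [show (π / h * (x + η * I) : ℂ) = (π / h : ℝ) * (x + η * I) by push_cast; rfl,
      Complex.im_ofReal_mul]
    simp
  exact him ▸ sinh_le_norm_sin _

theorem sinh_abs_pos {η h : ℝ} (hη : η ≠ 0) (hh : h ≠ 0) : 0 < sinh |π / h * η| :=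
  sinh_pos_iff.2 (abs_pos.2 (mul_ne_zero (div_ne_zero pi_ne_zero hh) hη))

theorem norm_inv_sin_line_le {η h : ℝ} (hη : η ≠ 0) (hh : h ≠ 0) (x : ℝ) :
    ‖(Complex.sin (π / h * (x + η * I)))⁻¹‖ ≤ (sinh |π / h * η|)⁻¹ := by
  rw [norm_inv]
  exact inv_anti₀ (sinh_abs_pos hη hh) (sinh_le_norm_sin_line η h x)

theorem norm_remainderKernel_le {η h : ℝ} (hη : η ≠ 0) (hh : h ≠ 0) (s x : ℝ) :
    ‖remainderKernel η h s x‖ ≤ |η|⁻¹ * (sinh |π / h * η|)⁻¹ := by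
  have hsin : ‖(sin (π / h * s) : ℂ)‖ ≤ 1 := by
    rw [Complex.norm_real]
    exact abs_sin_le_one _
  rw [remainderKernel, norm_mul, norm_mul]
  exact mul_le_mul
    ((mul_le_of_le_one_right (norm_nonneg _) hsin).trans (norm_cauchyKernel_le hη s x))
    (norm_inv_sin_line_le hη hh x) (norm_nonneg _) (by positivity)

theorem continuous_uncurry_remainderKernel {η h : ℝ} (hη : η ≠ 0) (hh : h ≠ 0) :
    Continuous fun p : ℝ × ℝ ↦ remainderKernel η h p.1 p.2 := by
  refine Continuous.mul (.mul (.inv₀ (by fun_prop) fun p ↦ line_sub_ne_zero hη p.1 p.2)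
    (by fun_prop)) (.inv₀ (by fun_prop) fun p ↦ ?_)
  exact norm_pos_iff.1 ((sinh_abs_pos hη hh).trans_le (sinh_le_norm_sin_line η h p.2))

theorem integrable_remainderKernel_smul {g : ℝ → E} (hg : Integrable g) {η h : ℝ} (hη : η ≠ 0)
    (hh : h ≠ 0) (s : ℝ) : Integrable fun x ↦ remainderKernel η h s x • g x :=
  hg.bdd_smul (|η|⁻¹ * (sinh |π / h * η|)⁻¹)
    ((continuous_uncurry_remainderKernel hη hh).comp (.prodMk_right s)).aestronglyMeasurable
    (.of_forall (norm_remainderKernel_le hη hh s))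

/-- The defect of sinc interpolation, with mesh `h`, of the Cauchy transform of `g`. -/
noncomputable def lineRemainder (g : ℝ → E) (η h s : ℝ) : E :=
  ∫ x, remainderKernel η h s x • g x

theorem hasSum_sinc_smul_cauchyTransform [CompleteSpace E] {g : ℝ → E} (hg : Integrable g)
    {η h : ℝ} (hη : η ≠ 0) (hh : h ≠ 0) (s : ℝ) :
    HasSum (fun k : ℤ ↦ sinc (π * (s / h - k)) • cauchyTransform g η (k * h))
      (cauchyTransform g η s - lineRemainder g η h s) := by
  let a (j : ℤ) : ℝ := (1 + |(j : ℝ)|)⁻¹ ^ 2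
  let B : ℝ := |h|⁻¹ * (4 * (1 + |η / h|⁻¹))
  have hshift (m : ℤ) : HasSum (fun k ↦ a (k - m)) (∑' j, a j) :=
    (Equiv.subRight m).hasSum_iff.2 summable_inv_one_add_abs_sq.hasSum
  have hbound (x : ℝ) : HasSum
      (fun k ↦ B * (a (k - round (s / h)) + a (k - round ((x + η * I) / h : ℂ).re)) * ‖g x‖)
      (B * (∑' j, a j + ∑' j, a j) * ‖g x‖) :=
    (((hshift _).add (hshift _)).mul_left B).mul_right _
  have hsum := hasSum_integral_of_dominated_convergence
    (F := fun (k : ℤ) x ↦ (sinc (π * (s / h - k)) * cauchyKernel η (k * h) x) • g x)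
    (f := fun x ↦ (cauchyKernel η s x - remainderKernel η h s x) • g x)
    (fun (k : ℤ) x ↦
      B * (a (k - round (s / h)) + a (k - round ((x + η * I) / h : ℂ).re)) * ‖g x‖)
    (fun k ↦ ((continuous_cauchyKernel hη _).const_mul _).aestronglyMeasurable.smul
      hg.aestronglyMeasurable)
    (fun k ↦ .of_forall fun x ↦ by
      rw [norm_smul]
      gcongr
      exact norm_sinc_mul_cauchyKernel_le hη hh s x k)
    (.of_forall fun x ↦ (hbound x).summable)
    (by simpa only [(hbound _).tsum_eq] using hg.norm.const_mul _)
    (.of_forall fun x ↦ (hasSum_sinc_mul_cauchyKernel hη hh s x).smul_const (g x))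
  rw [cauchyTransform, lineRemainder, ← integral_sub (integrable_cauchyKernel_smul hg hη s)
    (integrable_remainderKernel_smul hg hη hh s)]
  simp_rw [← sub_smul]
  refine hsum.congr_fun fun k ↦ ?_
  simp_rw [mul_smul, integral_smul, cauchyTransform, Complex.coe_smul]

theorem integrable_uncurry_remainderKernel_smul {g : ℝ → E} (hg : Integrable g) {η h : ℝ}
    (hη : η ≠ 0) (hh : h ≠ 0) (a b : ℝ) :
    Integrable (fun p : ℝ × ℝ ↦ remainderKernel η h p.1 p.2 • g p.2)
      ((volume.restrict (uIoc a b)).prod volume) :=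
  haveI : IsFiniteMeasure (volume.restrict (uIoc a b)) := ⟨by simp [uIoc]⟩
  (hg.comp_snd _).bdd_smul (|η|⁻¹ * (sinh |π / h * η|)⁻¹)
    (continuous_uncurry_remainderKernel hη hh).aestronglyMeasurable
    (.of_forall fun p ↦ norm_remainderKernel_le hη hh p.1 p.2)

theorem intervalIntegrable_lineRemainder {g : ℝ → E} (hg : Integrable g) {η h : ℝ}
    (hη : η ≠ 0) (hh : h ≠ 0) (a b : ℝ) :
    IntervalIntegrable (lineRemainder g η h) volume a b :=
  intervalIntegrable_iff.2 (integrable_uncurry_remainderKernel_smul hg hη hh a b).integral_prod_left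

theorem norm_integral_remainderKernel_le {η h a b : ℝ} (hη : η ≠ 0) (hh : 0 < h) (hab : a ≤ b)
    (x : ℝ) : ‖∫ s in a..b, remainderKernel η h s x‖ ≤ h / |η| * (sinh |π / h * η|)⁻¹ := by
  simp_rw [remainderKernel]
  rw [intervalIntegral.integral_mul_const, norm_mul]
  gcongr
  · have hosc := norm_integral_cauchyKernel_mul_sin_le (div_pos pi_pos hh) hη hab x
    refine hosc.trans_eq ?_
    field_simp
  · exact norm_inv_sin_line_le hη hh.ne' x

theorem norm_integral_lineRemainder_le [CompleteSpace E] {g : ℝ → E} (hg : Integrable g)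
    {η h a b : ℝ} (hη : η ≠ 0) (hh : 0 < h) (hab : a ≤ b) :
    ‖∫ s in a..b, lineRemainder g η h s‖ ≤ h / |η| * (sinh |π / h * η|)⁻¹ * ∫ x, ‖g x‖ := by
  have hswap := intervalIntegral_integral_swap (f := fun s x ↦ remainderKernel η h s x • g x)
    (integrable_uncurry_remainderKernel_smul hg hη hh.ne' a b)
  simp_rw [lineRemainder]
  rw [hswap, ← integral_const_mul]
  refine norm_integral_le_of_norm_le (hg.norm.const_mul _) (.of_forall fun x ↦ ?_)
  rw [intervalIntegral.integral_smul_const, norm_smul]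
  gcongr
  exact norm_integral_remainderKernel_le hη hh hab x

end Interpolation

section Discretization

variable {E : Type*} [NormedAddCommGroup E] [NormedSpace ℂ E] {F : ℂ → E} {d δ : ℝ}

/-- The error at `s` of the sinc interpolation of `F` with mesh `h`, as a contour integral over
the lines `Im ζ = ±δ`. -/
noncomputable def stripRemainder (F : ℂ → E) (δ h s : ℝ) : E :=
  (2 * π * I)⁻¹ • (lineRemainder (onLine F (-δ)) (-δ) h s - lineRemainder (onLine F δ) δ h s)

theorem IsStripIntegrable.hasSum_sinc_smul [CompleteSpace E] (hF : IsStripIntegrable F d δ)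
    {h : ℝ} (hh : h ≠ 0) (s : ℝ) :
    HasSum (fun k : ℤ ↦ sinc (π * (s / h - k)) • F (k * h : ℝ)) (F s - stripRemainder F δ h s) := by
  have hcauchy (t : ℝ) : F t = (2 * π * I : ℂ)⁻¹ •
      (cauchyTransform (onLine F (-δ)) (-δ) t - cauchyTransform (onLine F δ) δ t) := by
    rw [hF.cauchyTransform_neg_sub, inv_smul_smul₀ Complex.two_pi_I_ne_zero]
  have hlines := ((hasSum_sinc_smul_cauchyTransform hF.integrable_neg
    (neg_ne_zero.2 hF.pos.ne') hh s).sub (hasSum_sinc_smul_cauchyTransform hF.integrable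
      hF.pos.ne' hh s)).const_smul (2 * π * I : ℂ)⁻¹
  simp_rw [hcauchy, stripRemainder, ← smul_sub]
  convert hlines using 1
  · funext k
    rw [smul_comm, smul_sub]
  · congr 1
    abel

theorem IsStripIntegrable.intervalIntegrable_stripRemainder (hF : IsStripIntegrable F d δ)
    {h : ℝ} (hh : h ≠ 0) (a b : ℝ) : IntervalIntegrable (stripRemainder F δ h) volume a b :=
  ((intervalIntegrable_lineRemainder hF.integrable_neg (neg_ne_zero.2 hF.pos.ne') hh a b).sub
    (intervalIntegrable_lineRemainder hF.integrable hF.pos.ne' hh a b)).smul _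

theorem IsStripIntegrable.norm_integral_stripRemainder_le [CompleteSpace E]
    (hF : IsStripIntegrable F d δ) {h : ℝ} (hh : 0 < h) {a b : ℝ} (hab : a ≤ b) :
    ‖∫ s in a..b, stripRemainder F δ h s‖ ≤ h / (2 * π * δ * sinh (π * δ / h)) *
      ((∫ x, ‖onLine F (-δ) x‖) + ∫ x, ‖onLine F δ x‖) := by
  have hδ := hF.pos
  have hδ' := neg_ne_zero.2 hδ.ne'
  have hneg := norm_integral_lineRemainder_le hF.integrable_neg hδ' hh hab
  have hpos := norm_integral_lineRemainder_le hF.integrable hδ.ne' hh hab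
  rw [mul_neg, abs_neg, abs_neg] at hneg
  have : 0 < sinh (π * δ / h) := sinh_pos_iff.2 (by positivity)
  have hnorm : ‖(2 * π * I : ℂ)⁻¹‖ = (2 * π)⁻¹ := by simp [abs_of_pos pi_pos]
  simp_rw [stripRemainder]
  rw [intervalIntegral.integral_smul, intervalIntegral.integral_sub
    (intervalIntegrable_lineRemainder hF.integrable_neg hδ' hh.ne' a b)
    (intervalIntegrable_lineRemainder hF.integrable hδ.ne' hh.ne' a b), norm_smul, hnorm]
  calc _ ≤ (2 * π)⁻¹ * (h / |δ| * (sinh |π / h * δ|)⁻¹ * (∫ x, ‖onLine F (-δ) x‖) +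
        h / |δ| * (sinh |π / h * δ|)⁻¹ * ∫ x, ‖onLine F δ x‖) := by
        gcongr
        exact (norm_sub_le _ _).trans (add_le_add hneg hpos)
    _ = _ := by
        rw [abs_of_pos (by positivity : 0 < π / h * δ), abs_of_pos hδ, div_mul_eq_mul_div]
        field_simp

theorem IsStripIntegrable.hasSum_J_sub_smul [CompleteSpace E] (hF : IsStripIntegrable F d δ)
    (hreal : Integrable fun x : ℝ ↦ F x) {h : ℝ} (hh : h ≠ 0)
    (hsum : Summable fun k : ℤ ↦ ‖F (k * h : ℝ)‖) (a b : ℝ) :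
    HasSum (fun k : ℤ ↦ (J k h b - J k h a) • F (k * h : ℝ))
      ((∫ s in a..b, F s) - ∫ s in a..b, stripRemainder F δ h s) := by
  rw [← intervalIntegral.integral_sub hreal.intervalIntegrable
    (hF.intervalIntegrable_stripRemainder hh a b)]
  simp_rw [← integral_sinc_eq_J_sub _ hh, ← intervalIntegral.integral_smul_const]
  refine intervalIntegral.hasSum_integral_of_dominated_convergence
    (fun k _ ↦ ‖F (k * h : ℝ)‖) (fun k ↦ ?_) (fun k ↦ .of_forall fun s _ ↦ ?_)
    (.of_forall fun _ _ ↦ hsum) intervalIntegrable_const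
    (.of_forall fun s _ ↦ hF.hasSum_sinc_smul hh s)
  · exact Continuous.aestronglyMeasurable (by fun_prop)
  · rw [norm_smul]
    exact mul_le_of_le_one_left (norm_nonneg _) (abs_sinc_le_one _)

theorem summable_J_smul {u : ℤ → E} (hu : Summable fun k ↦ ‖u k‖) {h : ℝ} (hh : 0 ≤ h) (x : ℝ) :
    Summable fun k ↦ ‖J k h x • u k‖ := by
  refine .of_nonneg_of_le (fun _ ↦ norm_nonneg _) (fun k ↦ ?_) (hu.mul_left (1.1 * h))
  rw [norm_smul]
  gcongr
  exact abs_J_le k hh x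

theorem tendsto_tsum_J_smul_atBot [CompleteSpace E] {u : ℤ → E}
    (hu : Summable fun k ↦ ‖u k‖) {h : ℝ} (hh : 0 < h) :
    Tendsto (fun a ↦ ∑' k, J k h a • u k) atBot (𝓝 0) := by
  have h0 := tendsto_tsum_of_dominated_convergence (f := fun a k ↦ J k h a • u k)
    (g := fun _ ↦ (0 : E)) (bound := fun k ↦ 1.1 * h * ‖u k‖) (𝓕 := atBot) (hu.mul_left _)
    (fun k ↦ by simpa using (tendsto_J_atBot k hh).smul_const (u k))
    (.of_forall fun a k ↦ by
      rw [norm_smul]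
      gcongr
      exact abs_J_le k hh.le a)
  simpa using h0

theorem IsStripIntegrable.norm_integral_Iic_sub_tsum_le [CompleteSpace E]
    (hF : IsStripIntegrable F d δ) (hreal : Integrable fun x : ℝ ↦ F x) {h : ℝ} (hh : 0 < h)
    (hsum : Summable fun k : ℤ ↦ ‖F (k * h : ℝ)‖) (b : ℝ) :
    ‖(∫ s in Iic b, F s) - ∑' k : ℤ, J k h b • F (k * h : ℝ)‖ ≤
      h / (2 * π * δ * sinh (π * δ / h)) *
        ((∫ x, ‖onLine F (-δ) x‖) + ∫ x, ‖onLine F δ x‖) := by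
  have hlim := (intervalIntegral_tendsto_integral_Iic b hreal.integrableOn tendsto_id).sub
    ((tendsto_const_nhds (x := ∑' k : ℤ, J k h b • F (k * h : ℝ))).sub
      (tendsto_tsum_J_smul_atBot hsum hh))
  rw [sub_zero] at hlim
  refine le_of_tendsto hlim.norm ?_
  filter_upwards [eventually_le_atBot b] with a hab
  have hJ := (hF.hasSum_J_sub_smul hreal hh.ne' hsum a b).tsum_eq
  simp_rw [sub_smul] at hJ
  rw [(summable_J_smul hsum hh.le b).of_norm.tsum_sub (summable_J_smul hsum hh.le a).of_norm] at hJ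
  rw [id, hJ, sub_sub_cancel]
  exact hF.norm_integral_stripRemainder_le hh hab

end Discretization

section ExpDecay

theorem hasSum_indicator_Ioi_exp {γ h : ℝ} (hγ : 0 < γ) (hh : 0 < h) (N : ℤ) :
    HasSum ((Ioi N).indicator fun k : ℤ ↦ exp (-γ * (k * h)))
      (exp (-(γ * (N * h))) * (exp (-(γ * h)) * (1 - exp (-(γ * h)))⁻¹)) := by
  have hgeom := ((hasSum_geometric_of_lt_one (exp_nonneg _)
    (exp_lt_one_iff.2 (neg_neg_of_pos (mul_pos hγ hh)))).mul_left (exp (-(γ * h)))).mul_left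
      (exp (-(γ * (N * h))))
  have hinj : Function.Injective fun j : ℕ ↦ N + 1 + (j : ℤ) := fun a b hab ↦ by
    simpa using hab
  refine (hinj.hasSum_iff fun k hk ↦ indicator_of_notMem (fun hN ↦ hk ?_) _).1
    (hgeom.congr_fun fun j ↦ ?_)
  · exact ⟨(k - (N + 1)).toNat, by have := mem_Ioi.1 hN; grind⟩
  · rw [Function.comp_apply, indicator_of_mem (by grind), ← exp_nat_mul, ← exp_add, ← exp_add]
    push_cast
    ring_nf

theorem exp_neg_mul_inv_one_sub_le {t : ℝ} (ht : 0 < t) :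
    exp (-t) * (1 - exp (-t))⁻¹ ≤ t⁻¹ := by
  have h1 : 0 < 1 - exp (-t) := sub_pos.2 (exp_lt_one_iff.2 (neg_neg_of_pos ht))
  have h2 : exp (-t) * (t + 1) ≤ 1 := by
    calc exp (-t) * (t + 1) ≤ exp (-t) * exp t := by
          gcongr
          exact add_one_le_exp t
      _ = 1 := by rw [← exp_add, neg_add_cancel, exp_zero]
  rw [← div_eq_mul_inv, inv_eq_one_div, div_le_div_iff₀ h1 ht]
  linarith

theorem tsum_indicator_Ioi_exp_le {γ h : ℝ} (hγ : 0 < γ) (hh : 0 < h) (N : ℤ) :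
    ∑' k, (Ioi N).indicator (fun k : ℤ ↦ exp (-γ * (k * h))) k ≤
      exp (-(γ * (N * h))) / (γ * h) := by
  rw [(hasSum_indicator_Ioi_exp hγ hh N).tsum_eq, div_eq_mul_inv]
  gcongr
  exact exp_neg_mul_inv_one_sub_le (mul_pos hγ hh)

theorem indicator_Iio_neg_exp (γ h : ℝ) (M k : ℤ) :
    (Iio (-M)).indicator (fun k : ℤ ↦ exp (γ * (k * h))) k =
      (Ioi M).indicator (fun k : ℤ ↦ exp (-γ * (k * h))) (-k) := by
  simp only [indicator, mem_Iio, mem_Ioi, lt_neg, Int.cast_neg, neg_mul, mul_neg, neg_neg]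

theorem norm_tsum_sub_sum_le {ι E : Type*} [NormedAddCommGroup E] {u : ι → E} {v : ι → ℝ} {S : ℝ}
    (hu : Summable u) (hv : HasSum v S) (hv0 : ∀ k, 0 ≤ v k) {s : Finset ι}
    (huv : ∀ k ∉ s, ‖u k‖ ≤ v k) : ‖(∑' k, u k) - ∑ k ∈ s, u k‖ ≤ S := by
  have hs := hasSum_subtype_iff_indicator.1 (s.hasSum u)
  refine (hu.hasSum.sub hs).norm_le_of_bounded hv fun k ↦ ?_
  by_cases hk : k ∈ s
  · simpa [hk] using hv0 k
  · simpa [hk] using huv k hk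

variable {E : Type*} [NormedAddCommGroup E] {g : ℝ → E} {A α β : ℝ}

/-- `g` decays like `A exp (-α |x|)` to the left and like `A exp (-β |x|)` to the right. -/
structure TwoSidedExpDecay (g : ℝ → E) (A α β : ℝ) : Prop where
  left : ∀ x ≤ 0, ‖g x‖ ≤ A * exp (α * x)
  right : ∀ x, 0 ≤ x → ‖g x‖ ≤ A * exp (-β * x)

namespace TwoSidedExpDecay

theorem nonneg (hg : TwoSidedExpDecay g A α β) : 0 ≤ A := by
  simpa using (norm_nonneg _).trans (hg.left 0 le_rfl)

theorem norm_le (hg : TwoSidedExpDecay g A α β) (hα : 0 ≤ α) (hβ : 0 ≤ β) (x : ℝ) : ‖g x‖ ≤ A := by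
  rcases le_total x 0 with hx | hx
  · refine (hg.left x hx).trans (mul_le_of_le_one_right hg.nonneg (exp_le_one_iff.2 ?_))
    exact mul_nonpos_of_nonneg_of_nonpos hα hx
  · refine (hg.right x hx).trans (mul_le_of_le_one_right hg.nonneg (exp_le_one_iff.2 ?_))
    exact mul_nonpos_of_nonpos_of_nonneg (neg_nonpos.2 hβ) hx

theorem integrable (hg : TwoSidedExpDecay g A α β) (hm : AEStronglyMeasurable g) (hα : 0 < α)
    (hβ : 0 < β) : Integrable g := by
  rw [← integrableOn_univ, ← Iic_union_Ioi (a := (0 : ℝ)), integrableOn_union]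
  constructor
  · exact ((integrableOn_exp_mul_Iic hα 0).const_mul A).mono' hm.restrict
      (ae_restrict_of_forall_mem measurableSet_Iic hg.left)
  · exact ((integrableOn_exp_mul_Ioi (neg_lt_zero.2 hβ) 0).const_mul A).mono' hm.restrict
      (ae_restrict_of_forall_mem measurableSet_Ioi fun x hx ↦ hg.right x (le_of_lt hx))

theorem integral_norm_le (hg : TwoSidedExpDecay g A α β) (hm : AEStronglyMeasurable g)
    (hα : 0 < α) (hβ : 0 < β) : ∫ x, ‖g x‖ ≤ A / α + A / β := by
  have hint := (hg.integrable hm hα hβ).norm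
  rw [← intervalIntegral.integral_Iic_add_Ioi (b := (0 : ℝ)) hint.integrableOn hint.integrableOn]
  gcongr
  · calc ∫ x in Iic 0, ‖g x‖ ≤ ∫ x in Iic (0 : ℝ), A * exp (α * x) :=
          setIntegral_mono_on hint.integrableOn ((integrableOn_exp_mul_Iic hα 0).const_mul A)
            measurableSet_Iic hg.left
      _ = A / α := by
          rw [integral_const_mul, integral_exp_mul_Iic hα, mul_zero, exp_zero, mul_one_div]
  · have hβ' := neg_lt_zero.2 hβ
    calc ∫ x in Ioi 0, ‖g x‖ ≤ ∫ x in Ioi (0 : ℝ), A * exp (-β * x) :=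
          setIntegral_mono_on hint.integrableOn ((integrableOn_exp_mul_Ioi hβ' 0).const_mul A)
            measurableSet_Ioi fun x hx ↦ hg.right x (le_of_lt hx)
      _ = A / β := by
          rw [integral_const_mul, integral_exp_mul_Ioi hβ', mul_zero, exp_zero, neg_div_neg_eq,
            mul_one_div]

theorem summable_norm (hg : TwoSidedExpDecay g A α β) (hα : 0 < α) (hβ : 0 < β) {h : ℝ}
    (hh : 0 < h) : Summable fun k : ℤ ↦ ‖g (k * h)‖ := by
  have hexp {γ : ℝ} (hγ : 0 < γ) : Summable fun n : ℕ ↦ A * exp (n * -(γ * h)) :=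
    (summable_exp_nat_mul_iff.2 (neg_neg_of_pos (mul_pos hγ hh))).mul_left A
  refine .of_nat_of_neg (.of_nonneg_of_le (fun _ ↦ norm_nonneg _) (fun n ↦ ?_) (hexp hβ))
    (.of_nonneg_of_le (fun _ ↦ norm_nonneg _) (fun n ↦ ?_) (hexp hα))
  · refine (hg.right _ (by positivity)).trans_eq ?_
    push_cast
    ring_nf
  · refine (hg.left _ ?_).trans_eq ?_ <;> push_cast
    · exact mul_nonpos_of_nonpos_of_nonneg (neg_nonpos.2 n.cast_nonneg) hh.le
    · ring_nf

theorem norm_le_tails (hg : TwoSidedExpDecay g A α β) {h : ℝ} (hh : 0 ≤ h) {M N k : ℤ}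
    (hM : 0 ≤ M) (hN : 0 ≤ N) (hk : k ∉ Finset.Icc (-M) N) :
    ‖g (k * h)‖ ≤ A * ((Iio (-M)).indicator (fun k : ℤ ↦ exp (α * (k * h))) k +
      (Ioi N).indicator (fun k : ℤ ↦ exp (-β * (k * h))) k) := by
  rw [Finset.mem_Icc, not_and_or, not_le, not_le] at hk
  rcases hk with hk | hk
  · have hk0 : (k : ℝ) ≤ 0 := by exact_mod_cast (by omega : k ≤ 0)
    have hN' : k ∉ Ioi N := by grind
    rw [indicator_of_mem (mem_Iio.2 hk), indicator_of_notMem hN', add_zero]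
    exact hg.left _ (mul_nonpos_of_nonpos_of_nonneg hk0 hh)
  · have hk0 : (0 : ℝ) ≤ k := by exact_mod_cast (by omega : 0 ≤ k)
    have hM' : k ∉ Iio (-M) := by grind
    rw [indicator_of_mem (mem_Ioi.2 hk), indicator_of_notMem hM', zero_add]
    exact hg.right _ (mul_nonneg hk0 hh)

theorem norm_tsum_smul_sub_sum_le [NormedSpace ℝ E] [CompleteSpace E]
    (hg : TwoSidedExpDecay g A α β) (hα : 0 < α) (hβ : 0 < β) {h : ℝ} (hh : 0 < h) {M N : ℤ}
    (hM : 0 ≤ M) (hN : 0 ≤ N) {w : ℤ → ℝ} {B : ℝ} (hw : ∀ k, |w k| ≤ B) :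
    ‖(∑' k : ℤ, w k • g (k * h)) - ∑ k ∈ Finset.Icc (-M) N, w k • g (k * h)‖ ≤
      B * A * (exp (-(α * (M * h))) / (α * h) + exp (-(β * (N * h))) / (β * h)) := by
  have hA := hg.nonneg
  have hB : 0 ≤ B := (abs_nonneg _).trans (hw 0)
  have hnorm (k : ℤ) : ‖w k • g (k * h)‖ ≤ B * ‖g (k * h)‖ := by
    rw [norm_smul]
    gcongr
    exact hw k
  have hsum : Summable fun k : ℤ ↦ w k • g (k * h) :=
    .of_norm_bounded ((hg.summable_norm hα hβ hh).mul_left B) hnorm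
  have hright := (hasSum_indicator_Ioi_exp hβ hh N).summable.hasSum
  have hleft := (Equiv.neg ℤ).hasSum_iff.2 (hasSum_indicator_Ioi_exp hα hh M).summable.hasSum
  simp_rw [Function.comp_def, Equiv.neg_apply, ← indicator_Iio_neg_exp] at hleft
  refine (norm_tsum_sub_sum_le hsum ((hleft.add hright).mul_left (B * A)) (fun k ↦ ?_)
    fun k hk ↦ ?_).trans ?_
  · exact mul_nonneg (mul_nonneg hB hA) (add_nonneg
      (indicator_nonneg (fun _ _ ↦ exp_nonneg _) _) (indicator_nonneg (fun _ _ ↦ exp_nonneg _) _))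
  · refine (hnorm k).trans ?_
    rw [mul_assoc]
    gcongr
    exact hg.norm_le_tails hh.le hM hN hk
  · gcongr
    exacts [tsum_indicator_Ioi_exp_le hα hh M, tsum_indicator_Ioi_exp_le hβ hh N]

end TwoSidedExpDecay

end ExpDecay

section Strip

variable {E : Type*} [NormedAddCommGroup E] [NormedSpace ℂ E] {F : ℂ → E} {d A α β : ℝ}

theorem continuous_onLine (hF : DifferentiableOn ℂ F (strip d)) {η : ℝ} (hη : |η| < d) :
    Continuous (onLine F η) :=
  hF.continuousOn.comp_continuous (by fun_prop) fun x ↦ by simpa [strip] using hη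

theorem isStripIntegrable_of_decay (hF : DifferentiableOn ℂ F (strip d)) (hα : 0 < α)
    (hβ : 0 < β) (hdecay : ∀ η : ℝ, |η| < d → TwoSidedExpDecay (onLine F η) A α β) {δ : ℝ}
    (hδ : 0 < δ) (hδd : δ < d) : IsStripIntegrable F d δ := by
  have hline {η : ℝ} (hη : |η| = δ) : Integrable (onLine F η) :=
    (hdecay η (hη.trans_lt hδd)).integrable
      (continuous_onLine hF (hη.trans_lt hδd)).aestronglyMeasurable hα hβ
  exact
    { pos := hδ
      lt := hδd
      differentiableOn := hF
      bounded := ⟨A, fun z hz ↦ onLine_re_im F z ▸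
        (hdecay z.im (hz.trans_lt hδd)).norm_le hα.le hβ.le z.re⟩
      integrable_neg := hline (by rw [abs_neg, abs_of_pos hδ])
      integrable := hline (abs_of_pos hδ) }

theorem norm_integral_Iic_sub_tsum_le_of_decay [CompleteSpace E] (hd : 0 < d)
    (hF : DifferentiableOn ℂ F (strip d)) (hα : 0 < α) (hβ : 0 < β)
    (hdecay : ∀ η : ℝ, |η| < d → TwoSidedExpDecay (onLine F η) A α β) {h : ℝ} (hh : 0 < h)
    (b : ℝ) :
    ‖(∫ s in Iic b, F s) - ∑' k : ℤ, J k h b • F (k * h : ℝ)‖ ≤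
      h / (2 * π * d * sinh (π * d / h)) * (2 * (A / α + A / β)) := by
  have hreal := onLine_zero F ▸ hdecay 0 (by rwa [abs_zero])
  have hcont := onLine_zero F ▸ continuous_onLine hF (η := 0) (by rwa [abs_zero])
  have : 0 < sinh (π * d / h) := sinh_pos_iff.2 (by positivity)
  have hlim : Tendsto (fun δ ↦ h / (2 * π * δ * sinh (π * δ / h)) * (2 * (A / α + A / β)))
      (𝓝[<] d) (𝓝 (h / (2 * π * d * sinh (π * d / h)) * (2 * (A / α + A / β)))) :=
    ((continuousAt_const.div (Continuous.continuousAt (by fun_prop)) (by positivity)).mul_const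
      _).tendsto.mono_left nhdsWithin_le_nhds
  refine ge_of_tendsto hlim ?_
  filter_upwards [Ioo_mem_nhdsLT hd] with δ ⟨hδ, hδd⟩
  have hline {η : ℝ} (hη : |η| = δ) : ∫ x, ‖onLine F η x‖ ≤ A / α + A / β :=
    (hdecay η (hη.trans_lt hδd)).integral_norm_le
      (continuous_onLine hF (hη.trans_lt hδd)).aestronglyMeasurable hα hβ
  have : 0 < sinh (π * δ / h) := sinh_pos_iff.2 (by positivity)
  refine ((isStripIntegrable_of_decay hF hα hβ hdecay hδ hδd).norm_integral_Iic_sub_tsum_le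
    (hreal.integrable hcont.aestronglyMeasurable hα hβ) hh
    (hreal.summable_norm hα hβ hh) b).trans ?_
  rw [two_mul (A / α + A / β)]
  gcongr
  exacts [hline (by rw [abs_neg, abs_of_pos hδ]), hline (abs_of_pos hδ)]

end Strip

section Pullback

theorem exp_abs_mul_cos_le_norm_cosh {z : ℂ} {δ : ℝ} (hδ : δ ≤ π / 2) (hz : |z.im| ≤ δ) :
    exp |z.re| / 2 * cos δ ≤ ‖Complex.cosh z‖ := by
  have hre : (Complex.cosh z).re = cosh z.re * cos z.im := by
    conv_lhs => rw [← Complex.re_add_im z, Complex.cosh_add, Complex.cosh_mul_I,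
      Complex.sinh_mul_I, ← mul_assoc, ← Complex.ofReal_cosh, ← Complex.ofReal_sinh,
      ← Complex.ofReal_cos, ← Complex.ofReal_sin, ← Complex.ofReal_mul, ← Complex.ofReal_mul]
    simp only [Complex.add_re, Complex.ofReal_re, Complex.re_ofReal_mul, Complex.I_re, mul_zero,
      add_zero]
  have hcos : cos δ ≤ cos z.im := by
    rw [← cos_abs z.im]
    exact cos_le_cos_of_nonneg_of_le_pi (abs_nonneg _) (by linarith [pi_pos]) hz
  have hcos0 : 0 ≤ cos δ := cos_nonneg_of_neg_pi_div_two_le_of_le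
    (by linarith [abs_nonneg z.im, pi_pos]) hδ
  have hcosh : exp |z.re| / 2 ≤ cosh z.re := by
    rw [← cosh_abs, cosh_eq]
    linarith [exp_pos (-|z.re|)]
  calc exp |z.re| / 2 * cos δ ≤ cosh z.re * cos z.im := by gcongr
    _ ≤ |(Complex.cosh z).re| := hre ▸ le_abs_self _
    _ ≤ ‖Complex.cosh z‖ := Complex.abs_re_le_norm _

theorem norm_E1_sinh (z : ℂ) (γ : ℝ) :
    ‖E1 (Complex.sinh z) γ‖ = 1 / ‖Complex.cosh z‖ ^ (γ + 1) := by
  rw [E1, add_comm 1, ← Complex.cosh_sq, norm_div, norm_one, Complex.norm_cpow_real, norm_pow,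
    ← rpow_natCast, ← rpow_mul (norm_nonneg _), Nat.cast_ofNat, mul_div_cancel₀ _ two_ne_zero]

variable {E : Type*} [NormedAddCommGroup E] [NormedSpace ℂ E] {f : ℂ → E} {d K α β δ : ℝ}

/-- The integrand transported to the strip by the change of variables `z = sinh ζ`. -/
noncomputable def pullback (f : ℂ → E) (ζ : ℂ) : E := Complex.cosh ζ • f (Complex.sinh ζ)

theorem differentiableOn_pullback (hf : DifferentiableOn ℂ f (Complex.sinh '' strip d)) :
    DifferentiableOn ℂ (pullback f) (strip d) :=
  Complex.differentiable_cosh.differentiableOn.smul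
    (hf.comp Complex.differentiable_sinh.differentiableOn (mapsTo_image _ _))

theorem norm_pullback_le {γ ν : ℝ} (hK : 0 ≤ K) (hγ : 0 ≤ γ) (hν : γ ≤ ν)
    (hδ : δ < π / 2) {z : ℂ} (hz : |z.im| ≤ δ)
    (hf : ‖f (Complex.sinh z)‖ ≤ K * ‖E1 (Complex.sinh z) γ‖) :
    ‖pullback f z‖ ≤ K * 2 ^ ν / cos δ ^ ν * exp (-γ * |z.re|) := by
  have hcos : 0 < cos δ := cos_pos_of_mem_Ioo ⟨by linarith [abs_nonneg z.im, pi_pos], hδ⟩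
  have hcosh_le := exp_abs_mul_cos_le_norm_cosh hδ.le hz
  have hlower : 0 < exp |z.re| / 2 * cos δ := by positivity
  have hcosh : 0 < ‖Complex.cosh z‖ := hlower.trans_le hcosh_le
  rw [norm_E1_sinh] at hf
  rw [pullback, norm_smul, mul_comm]
  calc ‖f (Complex.sinh z)‖ * ‖Complex.cosh z‖
      ≤ K * (1 / ‖Complex.cosh z‖ ^ (γ + 1)) * ‖Complex.cosh z‖ := by gcongr
    _ = K / ‖Complex.cosh z‖ ^ γ := by
      rw [rpow_add hcosh, rpow_one]
      field_simp
    _ ≤ K / (exp |z.re| / 2 * cos δ) ^ γ := by gcongr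
    _ = K * 2 ^ γ / cos δ ^ γ * exp (-γ * |z.re|) := by
      rw [mul_rpow (by positivity) hcos.le, div_rpow (by positivity) (by positivity), ← exp_mul,
        neg_mul, exp_neg, mul_comm γ]
      field_simp
    _ ≤ K * 2 ^ ν / cos δ ^ ν * exp (-γ * |z.re|) := by
      have htwo : (2 : ℝ) ^ γ ≤ 2 ^ ν := rpow_le_rpow_of_exponent_le one_le_two hν
      have hcos_pow : cos δ ^ ν ≤ cos δ ^ γ := rpow_le_rpow_of_exponent_ge hcos (cos_le_one _) hν
      gcongr

theorem twoSidedExpDecay_onLine_pullback (hK : 0 ≤ K) (hα : 0 ≤ α) (hβ : 0 ≤ β)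
    (hneg : ∀ z ∈ Complex.sinh '' stripNeg d, ‖f z‖ ≤ K * ‖E1 z α‖)
    (hpos : ∀ z ∈ Complex.sinh '' stripPos d, ‖f z‖ ≤ K * ‖E1 z β‖)
    (hδ : δ < π / 2) {η : ℝ} (hη : |η| ≤ δ) (hηd : |η| < d) :
    TwoSidedExpDecay (onLine (pullback f) η) (K * 2 ^ max α β / cos δ ^ max α β) α β := by
  have hre (x : ℝ) : (x + η * I : ℂ).re = x := by simp
  have him (x : ℝ) : (x + η * I : ℂ).im = η := by simp
  have hstrip (x : ℝ) : (x + η * I : ℂ) ∈ strip d := by rwa [strip, mem_ofPred_eq, him]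
  have hbound {γ x : ℝ} (hγ : 0 ≤ γ) (hγν : γ ≤ max α β)
      (hf : ‖f (Complex.sinh (x + η * I))‖ ≤ K * ‖E1 (Complex.sinh (x + η * I)) γ‖) :
      ‖onLine (pullback f) η x‖ ≤ K * 2 ^ max α β / cos δ ^ max α β * exp (-γ * |x|) := by
    have hle := norm_pullback_le hK hγ hγν hδ (by rwa [him]) hf
    rwa [hre] at hle
  have hright (x : ℝ) (hx : 0 ≤ x) : ‖onLine (pullback f) η x‖ ≤
      K * 2 ^ max α β / cos δ ^ max α β * exp (-β * x) := by
    simpa only [abs_of_nonneg hx] using hbound hβ (le_max_right α β)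
      (hpos _ (mem_image_of_mem _ ⟨hstrip x, by rwa [hre]⟩))
  refine ⟨fun x hx ↦ ?_, hright⟩
  rcases hx.lt_or_eq with hx | rfl
  · simpa only [abs_of_neg hx, neg_mul_neg] using hbound hα (le_max_left α β)
      (hneg _ (mem_image_of_mem _ ⟨hstrip x, by rwa [hre]⟩))
  · simpa only [mul_zero] using hright 0 le_rfl

theorem cosh_smul_eq_pullback (f : ℂ → E) (x : ℝ) : cosh x • f (sinh x) = pullback f x := by
  rw [pullback, ← Complex.coe_smul, Complex.ofReal_sinh, Complex.ofReal_cosh]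

theorem integral_Iic_eq_integral_pullback (f : ℂ → E) (τ : ℝ) :
    ∫ t in Iic τ, f (t : ℝ) = ∫ x in Iic (arsinh τ), pullback f (x : ℝ) := by
  have himage : sinh '' Iic (arsinh τ) = Iic τ := by
    simpa using sinhOrderIso.image_Iic (arsinh τ)
  rw [← himage, integral_image_eq_integral_abs_deriv_smul measurableSet_Iic
    (fun x _ ↦ (hasDerivAt_sinh x).hasDerivWithinAt) sinh_injective.injOn]
  simp_rw [abs_of_pos (cosh_pos _), cosh_smul_eq_pullback]

theorem integrable_pullback_iff :
    (Integrable fun x : ℝ ↦ pullback f x) ↔ Integrable fun t : ℝ ↦ f t := by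
  have h := integrableOn_image_iff_integrableOn_abs_deriv_smul MeasurableSet.univ
    (fun x _ ↦ (hasDerivAt_sinh x).hasDerivWithinAt) sinh_injective.injOn (fun t : ℝ ↦ f t)
  simp_rw [abs_of_pos (cosh_pos _), cosh_smul_eq_pullback] at h
  rw [image_univ, sinh_surjective.range_eq, integrableOn_univ, integrableOn_univ] at h
  exact h.symm

end Pullback

section MeshSize

variable {d μ : ℝ} {n : ℕ}

theorem meshSize_pos (hd : 0 < d) (hμ : 0 < μ) (hn : 1 ≤ n) : 0 < meshSize d μ n := by
  have : (0 : ℝ) < n := by exact_mod_cast hn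
  exact sqrt_pos.2 (by positivity)

theorem pi_mul_div_meshSize (hd : 0 < d) (hμ : 0 < μ) (hn : 1 ≤ n) :
    π * d / meshSize d μ n = √(π * d * μ * n) := by
  have : (0 : ℝ) < n := by exact_mod_cast hn
  rw [div_eq_iff (meshSize_pos hd hμ hn).ne', meshSize, ← sqrt_mul (by positivity)]
  conv_lhs => rw [← sqrt_sq (by positivity : 0 ≤ π * d)]
  congr 1
  field_simp

theorem mul_meshSize (d : ℝ) (hμ : 0 < μ) (hn : 1 ≤ n) :
    μ * n * meshSize d μ n = √(π * d * μ * n) := by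
  have : (0 : ℝ) < n := by exact_mod_cast hn
  rw [meshSize, ← sqrt_sq (by positivity : 0 ≤ μ * n), ← sqrt_mul (by positivity),
    sqrt_sq (by positivity)]
  congr 1
  field_simp

theorem meshSize_le (hd : 0 < d) (hμ : 0 < μ) (hn : 1 ≤ n) :
    meshSize d μ n ≤ d * √(π / (d * μ)) := by
  have : (1 : ℝ) ≤ n := by exact_mod_cast hn
  calc meshSize d μ n ≤ √(π * d / (μ * 1)) := by rw [meshSize]; gcongr
    _ = √(d ^ 2 * (π / (d * μ))) := by congr 1; field_simp
    _ = d * √(π / (d * μ)) := by rw [sqrt_mul (sq_nonneg d), sqrt_sq hd.le]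

end MeshSize

section Truncation

variable {α β : ℝ} {n : ℕ}

theorem min_mul_le_mul_lowerTrunc (hα : 0 < α) (n : ℕ) :
    min α β * n ≤ α * lowerTrunc α β n := by
  unfold lowerTrunc
  split_ifs with h
  · rw [h, Int.cast_natCast]
  · rw [(min_choice α β).resolve_left h, ← div_le_iff₀' hα]
    exact Int.le_ceil _

theorem min_mul_le_mul_upperTrunc (hβ : 0 < β) (n : ℕ) :
    min α β * n ≤ β * upperTrunc α β n := by
  unfold upperTrunc
  split_ifs with h
  · rw [h, ← div_le_iff₀' hβ]
    exact Int.le_ceil _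
  · rw [(min_choice α β).resolve_left h, Int.cast_natCast]

theorem nonneg_of_natCast_mul_le {γ μ : ℝ} {M : ℤ} (hγ : 0 < γ) (hμ : 0 ≤ μ)
    (h : μ * n ≤ γ * M) : 0 ≤ M := by
  have : 0 ≤ γ * (M : ℝ) := (by positivity : 0 ≤ μ * n).trans h
  exact_mod_cast nonneg_of_mul_nonneg_right this hγ

end Truncation

section ErrorBounds

variable {d h A α β μ E₀ ε : ℝ}

theorem inv_sinh_le (hE₀ : 0 < E₀) (hε : E₀ ≤ ε) :
    (sinh ε)⁻¹ ≤ 2 * exp (-ε) / (1 - exp (-2 * E₀)) := by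
  have hsinh : sinh ε = (1 - exp (-2 * ε)) / (2 * exp (-ε)) := by
    rw [sinh_eq, show -2 * ε = -ε + -ε by ring, exp_add, exp_neg]
    field_simp
  have hpos : 0 < 1 - exp (-2 * E₀) := sub_pos.2 (exp_lt_one_iff.2 (by linarith))
  have hexp : exp (-2 * ε) ≤ exp (-2 * E₀) := exp_le_exp.2 (by linarith)
  rw [hsinh, inv_div]
  exact div_le_div_of_nonneg_left (by positivity) hpos (by linarith)

theorem discretization_bound_le (hd : 0 < d) (hA : 0 ≤ A) (hμ : 0 < μ) (hα : μ ≤ α) (hβ : μ ≤ β)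
    {s : ℝ} (hh : 0 ≤ h) (hs : h ≤ d * s) (hE₀ : 0 < E₀) (hε : E₀ ≤ ε) :
    h / (2 * π * d * sinh ε) * (2 * (A / α + A / β)) ≤
      2 * A / μ * (1 / (1 - exp (-2 * E₀)) * s) * exp (-ε) := by
  have hq : 0 < 1 - exp (-2 * E₀) := sub_pos.2 (exp_lt_one_iff.2 (by linarith))
  have hsinh : 0 < sinh ε := sinh_pos_iff.2 (hE₀.trans_le hε)
  have hα0 := hμ.trans_le hα
  have hβ0 := hμ.trans_le hβ
  have hs0 : 0 ≤ s := nonneg_of_mul_nonneg_right (hh.trans hs) hd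
  calc h / (2 * π * d * sinh ε) * (2 * (A / α + A / β))
      = h / (2 * π * d) * (sinh ε)⁻¹ * (2 * (A / α + A / β)) := by field_simp
    _ ≤ d * s / (2 * π * d) * (2 * exp (-ε) / (1 - exp (-2 * E₀))) * (2 * (A / μ + A / μ)) := by
      have := inv_sinh_le hE₀ hε
      gcongr
    _ = 2 / π * (2 * A / μ * (1 / (1 - exp (-2 * E₀)) * s) * exp (-ε)) := by
      field_simp
      ring
    _ ≤ 2 * A / μ * (1 / (1 - exp (-2 * E₀)) * s) * exp (-ε) :=
      mul_le_of_le_one_left (by positivity) ((div_le_one pi_pos).2 two_le_pi)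

theorem truncation_bound_le (hA : 0 ≤ A) (hμ : 0 < μ) (hα : μ ≤ α) (hβ : μ ≤ β) (hh : 0 < h)
    {x y B : ℝ} (hB : 0 ≤ B) (hx : ε ≤ x) (hy : ε ≤ y) :
    B * h * A * (exp (-x) / (α * h) + exp (-y) / (β * h)) ≤ 2 * A / μ * B * exp (-ε) := by
  calc B * h * A * (exp (-x) / (α * h) + exp (-y) / (β * h))
      ≤ B * h * A * (exp (-ε) / (μ * h) + exp (-ε) / (μ * h)) := by gcongr
    _ = 2 * A / μ * B * exp (-ε) := by
      field_simp
      ring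

theorem C1_eq (d K α β : ℝ) :
    C1 d K α β =
      2 * (K * 2 ^ max α β / cos d ^ max α β) / min α β *
        (1 / (1 - exp (-2 * √(π * d * min α β))) * √(π / (d * min α β))) +
      2 * (K * 2 ^ max α β) / min α β * 1.1 := by
  rw [C1, rpow_add two_pos, rpow_one, one_div, mul_inv]
  ring

end ErrorBounds

section SincSum

variable {E : Type*} [NormedAddCommGroup E] {f : ℂ → E} {d K α β : ℝ}

theorem nonneg_of_norm_le_E1 (hd : 0 < d)
    (hpos : ∀ z ∈ Complex.sinh '' stripPos d, ‖f z‖ ≤ K * ‖E1 z β‖) : 0 ≤ K := by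
  have h := (norm_nonneg _).trans (hpos 0 ⟨0, by simpa [stripPos, strip] using hd, by simp⟩)
  simpa [E1] using h

variable [NormedSpace ℂ E]

/-- The sum `sincIndefSum` for integrands with values in a complex vector space. -/
noncomputable def sincSum (f : ℂ → E) (h : ℝ) (M N : ℤ) (τ : ℝ) : E :=
  ∑ k ∈ Finset.Icc (-M) N, J k h (arsinh τ) • cosh (k * h) • f (sinh (k * h))

theorem sincIndefSum_eq_sincSum (f : ℂ → ℂ) (h : ℝ) (M N : ℤ) (τ : ℝ) :
    sincIndefSum f h M N τ = sincSum f h M N τ := by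
  refine Finset.sum_congr rfl fun k _ ↦ ?_
  rw [Complex.real_smul, Complex.real_smul]
  ring

theorem norm_integral_Iic_sub_sincSum_le [CompleteSpace E] (hd : 0 < d) (hd' : d < π / 2)
    (hf : DifferentiableOn ℂ f (Complex.sinh '' strip d)) (hK : 0 ≤ K) (hα : 0 < α) (hβ : 0 < β)
    (hneg : ∀ z ∈ Complex.sinh '' stripNeg d, ‖f z‖ ≤ K * ‖E1 z α‖)
    (hpos : ∀ z ∈ Complex.sinh '' stripPos d, ‖f z‖ ≤ K * ‖E1 z β‖) {h : ℝ} (hh : 0 < h)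
    {M N : ℤ} (hM : 0 ≤ M) (hN : 0 ≤ N) (τ : ℝ) :
    ‖(∫ t in Iic τ, f (t : ℝ)) - sincSum f h M N τ‖ ≤
      h / (2 * π * d * sinh (π * d / h)) *
          (2 * (K * 2 ^ max α β / cos d ^ max α β / α + K * 2 ^ max α β / cos d ^ max α β / β)) +
        1.1 * h * (K * 2 ^ max α β) *
          (exp (-(α * (M * h))) / (α * h) + exp (-(β * (N * h))) / (β * h)) := by
  have hdecay {δ η : ℝ} := twoSidedExpDecay_onLine_pullback hK hα.le hβ.le hneg hpos
    (δ := δ) (η := η)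
  have hreal : TwoSidedExpDecay (fun x : ℝ ↦ pullback f x) (K * 2 ^ max α β) α β := by
    simpa only [onLine_zero, cos_zero, one_rpow, div_one] using
      hdecay (half_pos pi_pos) abs_zero.le (by rwa [abs_zero])
  rw [integral_Iic_eq_integral_pullback, sincSum]
  simp only [cosh_smul_eq_pullback]
  refine (norm_sub_le_norm_sub_add_norm_sub _
    (∑' k : ℤ, J k h (arsinh τ) • pullback f (k * h : ℝ)) _).trans (add_le_add ?_ ?_)
  · exact norm_integral_Iic_sub_tsum_le_of_decay hd (differentiableOn_pullback hf) hα hβ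
      (fun η hη ↦ hdecay hd' hη.le hη) hh (arsinh τ)
  · exact hreal.norm_tsum_smul_sub_sum_le hα hβ hh hM hN fun k ↦ abs_J_le k hh.le (arsinh τ)

theorem norm_integral_Iic_sub_sincSum_le_C1 [CompleteSpace E] (hd : 0 < d) (hd' : d < π / 2)
    (hf : DifferentiableOn ℂ f (Complex.sinh '' strip d)) (hK : 0 ≤ K) (hα : 0 < α) (hβ : 0 < β)
    (hneg : ∀ z ∈ Complex.sinh '' stripNeg d, ‖f z‖ ≤ K * ‖E1 z α‖)
    (hpos : ∀ z ∈ Complex.sinh '' stripPos d, ‖f z‖ ≤ K * ‖E1 z β‖) {n : ℕ} (hn : 1 ≤ n)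
    (τ : ℝ) :
    ‖(∫ t in Iic τ, f (t : ℝ)) - sincSum f (meshSize d (min α β) n)
        (lowerTrunc α β n) (upperTrunc α β n) τ‖ ≤
      C1 d K α β * exp (-√(π * d * min α β * n)) := by
  have hμ : 0 < min α β := lt_min hα hβ
  have hcos : 0 < cos d := cos_pos_of_mem_Ioo ⟨by linarith, hd'⟩
  have hh := meshSize_pos hd hμ hn
  have hM := min_mul_le_mul_lowerTrunc (β := β) hα n
  have hN := min_mul_le_mul_upperTrunc (α := α) hβ n
  have hsqrt : √(π * d * min α β) ≤ √(π * d * min α β * n) :=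
    sqrt_le_sqrt (le_mul_of_one_le_right (by positivity) (by exact_mod_cast hn))
  refine (norm_integral_Iic_sub_sincSum_le hd hd' hf hK hα hβ hneg hpos hh
    (nonneg_of_natCast_mul_le hα hμ.le hM) (nonneg_of_natCast_mul_le hβ hμ.le hN) τ).trans ?_
  rw [C1_eq, add_mul, pi_mul_div_meshSize hd hμ hn]
  gcongr ?_ + ?_
  · exact discretization_bound_le hd (by positivity) hμ (min_le_left α β) (min_le_right α β)
      hh.le (meshSize_le hd hμ hn) (sqrt_pos.2 (by positivity)) hsqrt
  · refine truncation_bound_le (by positivity) hμ (min_le_left α β) (min_le_right α β) hh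
      (by norm_num) ?_ ?_ <;> rw [← mul_meshSize d hμ hn, ← mul_assoc] <;> gcongr

theorem integrable_of_norm_le_E1 (hd : 0 < d) (hK : 0 ≤ K)
    (hf : DifferentiableOn ℂ f (Complex.sinh '' strip d)) (hα : 0 < α) (hβ : 0 < β)
    (hneg : ∀ z ∈ Complex.sinh '' stripNeg d, ‖f z‖ ≤ K * ‖E1 z α‖)
    (hpos : ∀ z ∈ Complex.sinh '' stripPos d, ‖f z‖ ≤ K * ‖E1 z β‖) :
    Integrable fun t : ℝ ↦ f t := by
  have hdecay := twoSidedExpDecay_onLine_pullback hK hα.le hβ.le hneg hpos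
    (half_pos pi_pos) abs_zero.le (by rwa [abs_zero])
  have hcont := continuous_onLine (differentiableOn_pullback hf) (η := 0) (by rwa [abs_zero])
  rw [← integrable_pullback_iff, ← onLine_zero]
  exact hdecay.integrable hcont.aestronglyMeasurable hα hβ

end SincSum

end SincIndef

theorem theorem3p1_general {E : Type*} [NormedAddCommGroup E] [NormedSpace ℂ E] [CompleteSpace E]
    (d : ℝ) (hd : 0 < d) (hd' : d < π / 2) (f : ℂ → E)
    (hf : DifferentiableOn ℂ f (Complex.sinh '' SincIndef.strip d))
    (K α β : ℝ) (hα : 0 < α) (hβ : 0 < β)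
    (hneg : ∀ z ∈ Complex.sinh '' SincIndef.stripNeg d, ‖f z‖ ≤ K * ‖SincIndef.E1 z α‖)
    (hpos : ∀ z ∈ Complex.sinh '' SincIndef.stripPos d, ‖f z‖ ≤ K * ‖SincIndef.E1 z β‖) :
    Integrable (fun t : ℝ ↦ f t) ∧
    ∀ n : ℕ, 1 ≤ n → ∀ τ : ℝ,
      ‖(∫ t in Set.Iic τ, f (t : ℝ)) -
        SincIndef.sincSum f (SincIndef.meshSize d (min α β) n)
          (SincIndef.lowerTrunc α β n) (SincIndef.upperTrunc α β n) τ‖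
        ≤ SincIndef.C1 d K α β * exp (-√(π * d * min α β * n)) := by
  have hK := SincIndef.nonneg_of_norm_le_E1 hd hpos
  exact ⟨SincIndef.integrable_of_norm_le_E1 hd hK hf hα hβ hneg hpos, fun _ hn τ ↦
    SincIndef.norm_integral_Iic_sub_sincSum_le_C1 hd hd' hf hK hα hβ hneg hpos hn τ⟩

theorem theorem3p1 (d : ℝ) (hd : 0 < d) (hd' : d < Real.pi / 2)
    (f : ℂ → ℂ) (hf : AnalyticOnNhd ℂ f (Complex.sinh '' SincIndef.strip d))
    (K α β : ℝ) (hK : 0 < K) (hα : 0 < α) (hβ : 0 < β)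
    (hneg : ∀ z ∈ Complex.sinh '' SincIndef.stripNeg d, ‖f z‖ ≤ K * ‖SincIndef.E1 z α‖)
    (hpos : ∀ z ∈ Complex.sinh '' SincIndef.stripPos d, ‖f z‖ ≤ K * ‖SincIndef.E1 z β‖) :
    MeasureTheory.Integrable (fun t : ℝ => f (t : ℂ)) ∧
    ∀ n : ℕ, 1 ≤ n →
      BddAbove (Set.range fun τ : ℝ =>
        ‖(∫ t in Set.Iic τ, f (t : ℂ)) -
          SincIndef.sincIndefSum f (SincIndef.meshSize d (min α β) n)
            (SincIndef.lowerTrunc α β n) (SincIndef.upperTrunc α β n) τ‖) ∧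
      (⨆ τ : ℝ,
        ‖(∫ t in Set.Iic τ, f (t : ℂ)) -
          SincIndef.sincIndefSum f (SincIndef.meshSize d (min α β) n)
            (SincIndef.lowerTrunc α β n) (SincIndef.upperTrunc α β n) τ‖)
        ≤ SincIndef.C1 d K α β * Real.exp (-√(Real.pi * d * min α β * n)) := by
  obtain ⟨hint, herr⟩ := theorem3p1_general d hd hd' f hf.differentiableOn K α β hα hβ hneg hpos
  refine ⟨hint, fun n hn ↦ ?_⟩
  simp_rw [SincIndef.sincIndefSum_eq_sincSum]
  exact ⟨⟨_, Set.forall_mem_range.2 (herr n hn)⟩, ciSup_le (herr n hn)⟩
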